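/- **Theorem (autocurriculum for RL fine-tuning, AutoTune.RL).** *Setting.* Let $\Sigma$ be a finite token set, $T\ge 1$, $\mathcal X\subseteq\Sigma^*$ a set of prompts (finite strings), $\rho$ a distribution on $\mathcal X$, and $\Pi$ a class of deterministic next-token predictors $\pi:\Sigma^*\to\Sigma$ of finite Natarajan dimension $d$; put $D=\max(d,1)$. For $\pi\in\Pi$ let $\pi_{1:T}(x)=(y_1,\dots,y_T)$, $y_t=\pi(x,y_1,\dots,y_{t-1})$, be its chain of thought and $\pi_T(x)=y_T$ its answer. Let $\mathcal V:\mathcal X\times\Sigma\to\{0,1\}$ be a verifier that accepts exactly one answer for each prompt, and for $f:\mathcal X\to\Sigma$ put $\mathrm{Acc}_\rho(f)=\mathbb E_{x\sim\rho}[\mathcal V(x,f(x))]$. Suppose some $\pi^\star\in\Pi$ has $\mathrm{Acc}_\rho(\pi^\star_T)=1$, and that the reference model $\pi_{\rm ref}:\mathcal X\to\Delta(\Sigma^T)$ has sequence-level coverage $C_{\rm seq}\ge 1$: $\pi_{\rm ref}(\pi^\star_{1:T}(x)\mid x)\ge 1/C_{\rm seq}$ for $\rho$-almost every $x$. Let $\varepsilon\in(0,1)$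 and $\delta\in(0,1/2)$. *Base learner* $\mathrm{RLFineTune}(x_1,\dots,x_N\,\|\,\delta')$. For each $i$ draw $\lceil C_{\rm seq}\log(4NC_{\rm seq}/\delta')\rceil$ independent responses from $\pi_{\rm ref}(\cdot\mid x_i)$ (none if $N=0$) and let $\widetilde D_i$ be the set of those drawn responses $y$ with $\pi_{\rm ref}(y\mid x_i)\ge 1/C_{\rm seq}$ and $\mathcal V(x_i,y_T)=1$. Return any $\widehat\pi\in\arg\min_{\pi\in\Pi}\frac1N\sum_i\mathbb 1(\pi_{1:T}(x_i)\notin\widetilde D_i)$. Its number of prompts is taken to be $n_{\rm prompt}(\varepsilon',\delta')=\big\lceil c_2\,\frac{d\log(T|\Sigma|C_{\rm seq})\log(1/\varepsilon')+\log(1/\delta')}{\varepsilon'}\big\rceil$. *Algorithm* $\mathrm{AutoTune.RL}$. Let $\mathrm{err}_\star=\frac14$ and $k=\lceil c_1\log(1/\varepsilon)/\mathrm{err}_\star^2\rceil$. Draw $n$ i.i.d. prompts from $\rho$ and split them into $k$ parts of $\lfloor n/k\rfloor$ prompts, discarding any remainder. Let $\beta^{k,k}_r=\mathbb 1(r\le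 k/2)$, $\beta^{j,k}_r=\mathrm{err}_\star\beta^{j+1,k}_r+(1-\mathrm{err}_\star)\beta^{j+1,k}_{r+1}$ for $j<k$, and $\alpha^{j,k}_r=\beta^{j+1,k}_r-\beta^{j+1,k}_{r+1}$. In phase $j=0,\dots,k-1$, with current models $\widehat\pi^0,\dots,\widehat\pi^{j-1}$, go through the $j$-th part; for each prompt $x$ compute $\mathrm{rank}_j(x)=\sum_{i<j}\mathcal V(x,\widehat\pi^i_T(x))$ (which generates $j$ responses) and accept $x$ independently with probability $\alpha^{j,k}_{\mathrm{rank}_j(x)}/\max_{0\le r\le j}\alpha^{j,k}_r$, stopping once $n_{\rm prompt}(\mathrm{err}_\star,\delta/k)$ prompts have been accepted. Run $\mathrm{RLFineTune}(\cdot\,\|\,\delta/k)$ on the accepted prompts to get $\widehat\pi^j$. The output $\widehat f(x)$ is a plurality vote of $\widehat\pi^0_T(x),\dots,\widehat\pi^{k-1}_T(x)$. All minimizers and ties may be chosen arbitrarily. The computational cost $n_{\rm comp}$ is the total number of length-$T$ responses generated, from $\pi_{\rm ref}$ or from the models $\widehat\pi^i$. *Claim.* There are absolute constants $c_1,c_2>0$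 and two absolute polylogarithmic functions $\mathrm{polylog}_{1}$, $\mathrm{polylog}_{2}$, where $\mathrm{polylog}_i(a_1,\dots,a_m)=A_i(1+\log a_1+\dots+\log a_m)^{p_i}$ with absolute $A_i>0$, $p_i\in\mathbb N$, such that in every such setting, with $n_0=\frac{D}{\varepsilon}\,\mathrm{polylog}_1(C_{\rm seq},\varepsilon^{-1},\delta^{-1},T,|\Sigma|)$, for every $n\ge n_0$: 1. with probability at least $1-\delta$, $\mathrm{Acc}_\rho(\widehat f)\ge 1-\varepsilon$; 2. surely, the number of responses generated from $\pi_{\rm ref}$ is at most $D\,C_{\rm seq}\cdot\mathrm{polylog}_2(D,C_{\rm seq},\varepsilon^{-1},\delta^{-1},T,|\Sigma|)$, and the number generated from learned models is at most $n\cdot\mathrm{polylog}_2(\varepsilon^{-1})$; 3. hence for $n=\lceil n_0\rceil$, surely $$n_{\rm comp}\le D\,C_{\rm seq}\cdot\mathrm{polylog}_2(D,C_{\rm seq},\varepsilon^{-1},\delta^{-1},T,|\Sigma|)+\frac{D}{\varepsilon}\cdot\mathrm{polylog}_2(C_{\rm seq},\varepsilon^{-1},\delta^{-1},T,|\Sigma|).$$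 -/

import Mathlib

open scoped ENNReal NNReal

noncomputable section

namespace AutoCurriculum

/-! ### Deterministic autoregressive models -/

/-- A deterministic next-token predictor: every prefix (a finite string of tokens) is mapped to the
token on which the next-token distribution is concentrated. -/
abbrev Model (Tok : Type*) := List Tok → Tok

/-- A length-`T` response (chain of thought). -/
abbrev Response (Tok : Type*) (T : ℕ) := Fin T → Tok

section Models

variable {Tok : Type*}

/-- The first `t` tokens that the model `π` generates autoregressively from the prompt `x`. -/
def generated (π : Model Tok) (x : List Tok) : ℕ → List Tok
  | 0 => []
  | t + 1 => generated π x t ++ [π (x ++ generated π x t)]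

/-- The length-`T` chain of thought `π_{1:T}(x)`: its token at (zero-based) position `t` is `π`
applied to the prompt followed by the tokens generated before. -/
def cot (π : Model Tok) (T : ℕ) (x : List Tok) : Response Tok T :=
  fun t => π (x ++ generated π x t)

/-- The last token of a response, that is, its answer. -/
def answer {T : ℕ} [NeZero T] (y : Response Tok T) : Tok :=
  y ⟨T - 1, Nat.sub_lt (NeZero.pos T) Nat.one_pos⟩

/-- The answer `π_T(x)` of the model `π` on the prompt `x`. -/
def modelAnswer (π : Model Tok) (T : ℕ) [NeZero T] (x : List Tok) : Tok :=
  answer (cot π T x)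

/-- `S` is shattered in the sense of Natarajan by the class `F`. -/
def NatarajanShatters {A B : Type*} (F : Set (A → B)) (S : Finset A) : Prop :=
  ∃ f g : A → B, (∀ a ∈ S, f a ≠ g a) ∧
    ∀ R : Finset A, R ⊆ S →
      ∃ h ∈ F, (∀ a ∈ R, h a = f a) ∧ (∀ a ∈ S, a ∉ R → h a = g a)

/-- The Natarajan dimension: the supremum of the sizes of the shattered finite sets. -/
def natarajanDim {A B : Type*} (F : Set (A → B)) : ℕ∞ :=
  ⨆ (S : Finset A) (_ : NatarajanShatters F S), (S.card : ℕ∞)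

/-! ### Accuracy, coverage -/

/-- The accuracy `E_{x ∼ ρ} [V(x, f(x))]` of an outcome-level model `f`. -/
def accuracy {X : Set (List Tok)} (ρ : PMF X) (V : X → Tok → Bool) (f : X → Tok) : ℝ≥0∞ :=
  ∑' x, ρ x * (if V x (f x) = true then 1 else 0)

/-- Sparse verifier: every prompt has exactly one correct answer. -/
def SparseVerifier {X : Set (List Tok)} (V : X → Tok → Bool) : Prop :=
  ∀ x, ∃! y, V x y = true

/-- Sequence-level coverage: for almost every prompt, the reference model gives the chain of thought
of `πstar` probability at least `1 / Cseq`. -/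
def SequenceCoverage {X : Set (List Tok)} {T : ℕ} (ρ : PMF X)
    (πref : X → PMF (Response Tok T)) (πstar : Model Tok) (Cseq : ℝ) : Prop :=
  ∀ x ∈ ρ.support, ENNReal.ofReal Cseq⁻¹ ≤ πref x (cot πstar T x)

/-! ### The weights of boosting by filtering -/

/-- The error level `err⋆` to which each model of the ensemble is trained. -/
def errStar : ℝ := 1 / 4

/-- `betaAux k i r` is `β^{k-i,k}_r`: the recursion runs over the number `i = k - j` of phases that
remain. -/
def betaAux (k : ℕ) : ℕ → ℕ → ℝ
  | 0, r => if (r : ℝ) ≤ (k : ℝ) / 2 then 1 else 0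
  | i + 1, r => errStar * betaAux k i r + (1 - errStar) * betaAux k i (r + 1)

/-- `β^{j,k}_r`, for `j ≤ k`. -/
def beta (j k r : ℕ) : ℝ := betaAux k (k - j) r

/-- `α^{j,k}_r = β^{j+1,k}_r - β^{j+1,k}_{r+1}`, for `j < k`. -/
def alpha (j k r : ℕ) : ℝ := beta (j + 1) k r - beta (j + 1) k (r + 1)

/-- `‖w_j‖_∞`, the maximum of `α^{j,k}_r` over `0 ≤ r ≤ j`. -/
def alphaMax (j k : ℕ) : ℝ :=
  (Finset.range (j + 1)).sup' Finset.nonempty_range_add_one (alpha j k)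

/-! ### Sampling -/

/-- `n` independent samples from `p`. -/
def iid {A : Type*} (p : PMF A) : ℕ → PMF (List A)
  | 0 => PMF.pure []
  | n + 1 => p.bind fun a => (iid p n).bind fun l => PMF.pure (a :: l)

/-- Numbers of length-`T` responses generated: from the reference model, and from models of the
learner. -/
structure Cost where
  ref : ℕ
  model : ℕ

/-- The computational cost: the total number of generated responses. (The verifier is applied at most
once to each of them, so this also bounds the number of verifier queries.) -/
def Cost.total (c : Cost) : ℕ := c.ref + c.model

/-! ### The base learner `RLFineTune` -/

/-- The number of responses that `RLFineTune` draws from the reference model for each of its `n`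
prompts: `⌈Cseq · log (4 n Cseq / δ)⌉`. -/
def rolloutsPerPrompt (Cseq δ : ℝ) (n : ℕ) : ℕ :=
  ⌈Cseq * Real.log (4 * n * Cseq / δ)⌉₊

/-- The responses that `RLFineTune` keeps for the prompt `x` out of the list `ys` of responses drawn
from the reference model: those with probability at least `1 / Cseq` under the reference model whose
answer is accepted by the verifier, without repetitions. -/
def keptResponses {X : Set (List Tok)} {T : ℕ} [NeZero T] (V : X → Tok → Bool)
    (πref : X → PMF (Response Tok T)) (Cseq : ℝ) (x : X) (ys : List (Response Tok T)) :
    Set (Response Tok T) :=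
  {y | y ∈ ys ∧ ENNReal.ofReal Cseq⁻¹ ≤ πref x y ∧ V x (answer y) = true}

/-- The labelled dataset of `RLFineTune`: for each prompt of the list, `m` independent responses are
drawn from the reference model and filtered. -/
def labelled {X : Set (List Tok)} {T : ℕ} [NeZero T] (V : X → Tok → Bool)
    (πref : X → PMF (Response Tok T)) (Cseq : ℝ) (m : ℕ) :
    List X → PMF (List (X × Set (Response Tok T)))
  | [] => PMF.pure []
  | x :: xs =>
      (iid (πref x) m).bind fun ys =>
        (labelled V πref Cseq m xs).bind fun rest =>
          PMF.pure ((x, keptResponses V πref Cseq x ys) :: rest)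

open scoped Classical in
/-- The empirical loss: the fraction of prompts on which the chain of thought of `π` is not one of
the kept responses. -/
def empiricalLoss {X : Set (List Tok)} {T : ℕ} (S : List (X × Set (Response Tok T)))
    (π : Model Tok) : ℝ :=
  (1 / (S.length : ℝ)) * (S.map fun s => if cot π T s.1 ∈ s.2 then (0 : ℝ) else 1).sum

/-- `erm` returns, for every labelled dataset, some minimizer over the class `Pi` of the empirical
loss. -/
def IsERM {X : Set (List Tok)} {T : ℕ} (Pi : Set (Model Tok))
    (erm : List (X × Set (Response Tok T)) → Model Tok) : Prop :=
  ∀ S, erm S ∈ Pi ∧ ∀ π ∈ Pi, empiricalLoss S (erm S) ≤ empiricalLoss S π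

/-- `RLFineTune` on the prompts `D` with failure probability `δ`. It returns a model and the number
of responses drawn from the reference model. -/
def rlFineTune {X : Set (List Tok)} {T : ℕ} [NeZero T] (V : X → Tok → Bool)
    (πref : X → PMF (Response Tok T)) (Cseq : ℝ)
    (erm : List (X × Set (Response Tok T)) → Model Tok) (δ : ℝ) (D : List X) :
    PMF (Model Tok × ℕ) :=
  (labelled V πref Cseq (rolloutsPerPrompt Cseq δ D.length) D).bind fun S =>
    PMF.pure (erm S, D.length * rolloutsPerPrompt Cseq δ D.length)

/-- The number of prompts `n_prompt(ε, δ, T)` requested by `RLFineTune`, with leading constant `c`,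
for a class of Natarajan dimension `d` over `s` tokens. -/
def rlSampleComplexity (c : ℝ) (d s T : ℕ) (Cseq ε δ : ℝ) : ℕ :=
  ⌈c * (d * Real.log (T * s * Cseq) * Real.log (1 / ε) + Real.log (1 / δ)) / ε⌉₊

/-! ### `Sample` -/

/-- `rank_j(x)`: the number of models in the ensemble that answer `x` correctly. -/
def rank {X : Set (List Tok)} (T : ℕ) [NeZero T] (V : X → Tok → Bool) (ens : List (Model Tok))
    (x : X) : ℕ :=
  ens.countP fun π => V x (modelAnswer π T x)

/-- The acceptance probability `w_j(x) / ‖w_j‖_∞`, with `j` the size of the ensemble. (This ratio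
lies in `[0,1]`; the truncation only makes this visible to the type checker.) -/
def acceptProb {X : Set (List Tok)} (T : ℕ) [NeZero T] (V : X → Tok → Bool) (k : ℕ)
    (ens : List (Model Tok)) (x : X) : ℝ≥0 :=
  min 1 (Real.toNNReal (alpha ens.length k (rank T V ens x) / alphaMax ens.length k))

/-- The loop of `Sample`: go through the prompts; stop as soon as `N` prompts have been collected;
otherwise generate one response from each model of the ensemble to determine the rank of the prompt,
and accept the prompt with probability `w_j(x) / ‖w_j‖_∞`. It returns the collected prompts and the
number of generated responses. -/
def sampleLoop {X : Set (List Tok)} (T : ℕ) [NeZero T] (V : X → Tok → Bool) (k N : ℕ)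
    (ens : List (Model Tok)) : List X → List X → PMF (List X × ℕ)
  | [], out => PMF.pure (out, 0)
  | x :: xs, out =>
      if N ≤ out.length then PMF.pure (out, 0)
      else
        (PMF.bernoulli (acceptProb T V k ens x) (min_le_left _ _)).bind fun a =>
          (sampleLoop T V k N ens xs (if a then out ++ [x] else out)).bind fun r =>
            PMF.pure (r.1, ens.length + r.2)

/-! ### `AutoTune` with base learner `RLFineTune` -/

/-- The phases of `AutoTune`, one for each part of the prompt dataset, started from the ensemble
`ens`. It returns the final ensemble and the cost. -/
def phases {X : Set (List Tok)} {T : ℕ} [NeZero T] (V : X → Tok → Bool)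
    (πref : X → PMF (Response Tok T)) (Cseq : ℝ)
    (erm : List (X × Set (Response Tok T)) → Model Tok) (k N : ℕ) (δ : ℝ) :
    List (List X) → List (Model Tok) → PMF (List (Model Tok) × Cost)
  | [], ens => PMF.pure (ens, ⟨0, 0⟩)
  | D :: parts, ens =>
      (sampleLoop T V k N ens D []).bind fun s =>
        (rlFineTune V πref Cseq erm (δ / k) s.1).bind fun b =>
          (phases V πref Cseq erm k N δ parts (ens ++ [b.1])).bind fun r =>
            PMF.pure (r.1, ⟨b.2 + r.2.ref, s.2 + r.2.model⟩)

/-- The `k` consecutive parts, of `⌊n / k⌋` elements each, of a list of `n` elements. -/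
def split {A : Type*} (k : ℕ) (D : List A) : List (List A) :=
  (List.range k).map fun j => (D.drop (j * (D.length / k))).take (D.length / k)

/-- `plu` returns a most frequent element of every nonempty list, ties being broken arbitrarily. -/
def IsPlurality [DecidableEq Tok] (plu : List Tok → Tok) : Prop :=
  ∀ l, l ≠ [] → ∀ z, l.count z ≤ l.count (plu l)

/-- The number of phases, with leading constant `c`. -/
def numPhases (c ε : ℝ) : ℕ := ⌈c * Real.log (1 / ε) / errStar ^ 2⌉₊

/-- `AutoTune.RL` on the prompt dataset `D`: it returns the outcome-level model (the plurality vote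
of the final ensemble) and the cost. The constants `ck` and `cn` are the leading constants of the
number of phases and of the sample complexity of the base learner, `d` is the Natarajan dimension of
the model class, and `s` is the number of tokens. -/
def autoTuneRL {X : Set (List Tok)} {T : ℕ} [NeZero T] (V : X → Tok → Bool)
    (πref : X → PMF (Response Tok T)) (Cseq : ℝ)
    (erm : List (X × Set (Response Tok T)) → Model Tok) (plu : List Tok → Tok)
    (ck cn : ℝ) (d s : ℕ) (ε δ : ℝ) (D : List X) : PMF ((X → Tok) × Cost) :=
  (phases V πref Cseq erm (numPhases ck ε)
      (rlSampleComplexity cn d s T Cseq errStar (δ / numPhases ck ε)) δ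
      (split (numPhases ck ε) D) []).bind fun r =>
    PMF.pure (fun x => plu (r.1.map fun π => modelAnswer π T x), r.2)

/-- `AutoTune.RL` on `n` independent prompts drawn from `ρ`. -/
def autoTuneRun {X : Set (List Tok)} {T : ℕ} [NeZero T] (ρ : PMF X) (V : X → Tok → Bool)
    (πref : X → PMF (Response Tok T)) (Cseq : ℝ)
    (erm : List (X × Set (Response Tok T)) → Model Tok) (plu : List Tok → Tok)
    (ck cn : ℝ) (d s : ℕ) (ε δ : ℝ) (n : ℕ) : PMF ((X → Tok) × Cost) :=
  (iid ρ n).bind fun D => autoTuneRL V πref Cseq erm plu ck cn d s ε δ D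

end Models

/-- The polylogarithmic factor `A (1 + ∑ log a)^p`, the sum being over the arguments `a ≥ 1`. -/
def polylog (A : ℝ) (p : ℕ) (args : List ℝ) : ℝ :=
  A * (1 + (args.map Real.log).sum) ^ p

end AutoCurriculum

end

/-! The proof is boosting by filtering, tracked by a potential. The number β^{j,k}_r is the
probability that r plus a binomial variable with k - j trials of success probability 3/4 is at most
k/2. The potential of an ensemble of size j is the mean of β^{j,k} at the rank of a random prompt.
It starts at β^{0,k}_0, which a Chernoff bound makes at most (√3/2)^k (`betaAux_le_pow`,
`beta_zero_sq_le`). At j = k it dominates the error of the vote: only one answer is correct, so a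
prompt of rank above k/2 has a correct strict majority (`errInd_vote_le`).

By the recursion for β, appending a model of error at most 1/4 under the distribution reweighted by
α does not increase the potential (`potential_append_le_of_err`). The sampler supplies independent
prompts from that distribution (`expect_sampleLoop_le_iid`). If the acceptance probability p is at
most τ = ε/(16k), no model at all can raise the potential by more than τ
(`potential_append_le_of_accept`). If p > τ, the sampler fills its quota with high probability
(`expect_sampleLoop_length_lt`). Over k phases the increases sum to at most ε/16, while the initial
value is at most 15ε/16.

For the base learner, call a prompt a failure of a model if its chain of thought is not covered or
its answer is rejected. This event does not involve the sampled responses. With high probability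
every kept set contains the chain of `πstar`, so the empirical minimizer has zero loss and hence no
failure on its prompts (`expect_rlFineTune_le`). It remains to exclude models without failures on
the sample but with a large failure probability. That is realizable uniform convergence, by
symmetrization with the weight 2^(ghost errors) (`expect_exists_consistent_le`). The failure pattern
on a prompt is determined by the next-token values on the prefixes of at most C covered responses.
Natarajan's lemma on these few prefixes therefore bounds the number of patterns
(`exists_cover_of_natarajanShatters`, `exists_cover_fails`).

The cost bounds hold on the whole support, since the sampler never returns more than N prompts. -/

namespace AutoCurriculum

/-! ### Expectations under discrete distributions -/

/-- The expectation of a nonnegative function under a discrete distribution. -/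
noncomputable def expect {A : Type*} (p : PMF A) (f : A → ℝ≥0∞) : ℝ≥0∞ := ∑' a, p a * f a

section Expect

variable {A B : Type*}

theorem expect_pure (a : A) (f : A → ℝ≥0∞) : expect (PMF.pure a) f = f a := by
  classical
  unfold expect
  rw [tsum_eq_single a]
  · simp
  · intro b hb
    simp [PMF.pure_apply, hb]

theorem expect_bind (p : PMF A) (q : A → PMF B) (f : B → ℝ≥0∞) :
    expect (p.bind q) f = expect p fun a => expect (q a) f := by
  unfold expect
  simp_rw [PMF.bind_apply, ← ENNReal.tsum_mul_right, ← ENNReal.tsum_mul_left]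
  rw [ENNReal.tsum_comm]
  simp_rw [mul_assoc]

theorem expect_mono_support (p : PMF A) {f g : A → ℝ≥0∞} (h : ∀ a ∈ p.support, f a ≤ g a) :
    expect p f ≤ expect p g := by
  refine ENNReal.tsum_le_tsum fun a => ?_
  by_cases ha : p a = 0
  · simp [ha]
  · gcongr
    exact h a ((p.mem_support_iff a).2 ha)

theorem expect_mono (p : PMF A) {f g : A → ℝ≥0∞} (h : ∀ a, f a ≤ g a) :
    expect p f ≤ expect p g :=
  expect_mono_support p fun a _ => h a

theorem expect_congr_support (p : PMF A) {f g : A → ℝ≥0∞} (h : ∀ a ∈ p.support, f a = g a) :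
    expect p f = expect p g :=
  le_antisymm (expect_mono_support p fun a ha => (h a ha).le)
    (expect_mono_support p fun a ha => (h a ha).ge)

theorem expect_const (p : PMF A) (c : ℝ≥0∞) : expect p (fun _ => c) = c := by
  unfold expect
  rw [ENNReal.tsum_mul_right, p.tsum_coe, one_mul]

theorem expect_le_of_support (p : PMF A) {f : A → ℝ≥0∞} {c : ℝ≥0∞}
    (h : ∀ a ∈ p.support, f a ≤ c) : expect p f ≤ c :=
  (expect_mono_support p h).trans_eq (expect_const p c)

theorem expect_le_of_le (p : PMF A) {f : A → ℝ≥0∞} {c : ℝ≥0∞} (h : ∀ a, f a ≤ c) :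
    expect p f ≤ c :=
  expect_le_of_support p fun a _ => h a

theorem expect_add (p : PMF A) (f g : A → ℝ≥0∞) :
    expect p (fun a => f a + g a) = expect p f + expect p g := by
  unfold expect
  simp_rw [mul_add]
  exact ENNReal.tsum_add

theorem expect_const_mul (p : PMF A) (c : ℝ≥0∞) (f : A → ℝ≥0∞) :
    expect p (fun a => c * f a) = c * expect p f := by
  unfold expect
  rw [← ENNReal.tsum_mul_left]
  exact tsum_congr fun a => by ring

theorem expect_mul_const (p : PMF A) (c : ℝ≥0∞) (f : A → ℝ≥0∞) :
    expect p (fun a => f a * c) = expect p f * c := by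
  simp_rw [mul_comm _ c]
  exact expect_const_mul p c f

theorem expect_comm (p : PMF A) (q : PMF B) (f : A → B → ℝ≥0∞) :
    expect p (fun a => expect q (f a)) = expect q fun b => expect p fun a => f a b := by
  unfold expect
  simp_rw [← ENNReal.tsum_mul_left]
  rw [ENNReal.tsum_comm]
  exact tsum_congr fun b => tsum_congr fun a => by ring

theorem expect_bernoulli (a : ℝ≥0) (h : a ≤ 1) (f : Bool → ℝ≥0∞) :
    expect (PMF.bernoulli a h) f = a * f true + (1 - a) * f false := by
  unfold expect
  rw [tsum_bool, add_comm]
  simp [PMF.bernoulli_apply]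

theorem expect_one_sub (p : PMF A) {f : A → ℝ≥0∞} (h : ∀ a, f a ≤ 1) :
    expect p (fun a => 1 - f a) = 1 - expect p f := by
  refine ENNReal.eq_sub_of_add_eq
    (ne_top_of_le_ne_top ENNReal.one_ne_top (expect_le_of_le p h)) ?_
  rw [← expect_add]
  simp_rw [tsub_add_cancel_of_le (h _)]
  exact expect_const p 1

theorem toOuterMeasure_eq_expect (p : PMF A) (S : Set A) :
    p.toOuterMeasure S = expect p (S.indicator 1) := by
  rw [PMF.toOuterMeasure_apply]
  refine tsum_congr fun a => ?_
  by_cases ha : a ∈ S <;> simp [ha]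

theorem one_sub_le_toOuterMeasure (p : PMF A) {S : Set A} {c : ℝ≥0∞}
    (h : expect p (Sᶜ.indicator 1) ≤ c) : 1 - c ≤ p.toOuterMeasure S := by
  rw [toOuterMeasure_eq_expect, tsub_le_iff_right]
  calc (1 : ℝ≥0∞) = expect p (S.indicator 1) + expect p (Sᶜ.indicator 1) := by
        rw [← expect_add, ← expect_const p 1]
        congr 1
        funext a
        by_cases ha : a ∈ S <;> simp [ha]
    _ ≤ _ := by gcongr

end Expect

/-! ### Independent samples -/

section Iid

variable {A : Type*}

theorem expect_iid_zero (p : PMF A) (f : List A → ℝ≥0∞) : expect (iid p 0) f = f [] :=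
  expect_pure _ _

theorem expect_iid_succ (p : PMF A) (n : ℕ) (f : List A → ℝ≥0∞) :
    expect (iid p (n + 1)) f = expect p fun a => expect (iid p n) fun l => f (a :: l) := by
  simp only [iid, expect_bind, expect_pure]

theorem expect_iid_add (p : PMF A) (m n : ℕ) (f : List A → ℝ≥0∞) :
    expect (iid p (m + n)) f =
      expect (iid p m) fun l => expect (iid p n) fun l' => f (l ++ l') := by
  induction m generalizing f with
  | zero => simp [expect_iid_zero]
  | succ m ih =>
    rw [Nat.add_right_comm, expect_iid_succ, expect_iid_succ]
    simp only [ih, List.cons_append]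

theorem mem_support_iid {p : PMF A} {n : ℕ} {l : List A} (h : l ∈ (iid p n).support) :
    l.length = n ∧ ∀ a ∈ l, a ∈ p.support := by
  induction n generalizing l with
  | zero => simp_all [iid]
  | succ n ih =>
    simp only [iid, PMF.mem_support_bind_iff, PMF.mem_support_pure_iff] at h
    obtain ⟨a, ha, l', hl', rfl⟩ := h
    obtain ⟨h1, h2⟩ := ih hl'
    refine ⟨by simp [h1], fun b hb => ?_⟩
    rcases List.mem_cons.1 hb with rfl | hb
    exacts [ha, h2 b hb]

/-- Used with `a` the chain of thought of `πstar`: the chance that all draws from the reference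
model miss it. -/
theorem expect_iid_notMem (p : PMF A) (n : ℕ) (a : A)
    [∀ l : List A, Decidable (a ∈ l)] :
    expect (iid p n) (fun l => if a ∈ l then 0 else 1) = (1 - p a) ^ n := by
  classical
  induction n with
  | zero => simp [expect_iid_zero]
  | succ n ih =>
    have h1 : ∀ b, expect (iid p n) (fun l => if a ∈ b :: l then (0 : ℝ≥0∞) else 1) =
        (1 - if b = a then 1 else 0) * (1 - p a) ^ n := by
      intro b
      by_cases hb : b = a
      · subst hb
        simp [expect_const]
      · have : ∀ l, a ∈ b :: l ↔ a ∈ l := fun l => by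
          simp [List.mem_cons, Ne.symm hb]
        simp [this, hb, ← ih]
    rw [expect_iid_succ]
    simp_rw [h1]
    rw [expect_mul_const, expect_one_sub, pow_succ', expect]
    · congr 2
      rw [tsum_eq_single a]
      · simp
      · intro b hb
        simp [hb]
    · intro b
      split_ifs <;> simp

-- The moment generating function of a binomial count at log 2. It turns an error of at least η into
-- a factor (1 + η)ⁿ on the ghost sample.
open scoped Classical in
theorem expect_iid_two_pow_countP (p : PMF A) (n : ℕ) (e : A → Prop) :
    expect (iid p n) (fun l => 2 ^ l.countP (fun a => decide (e a))) =
      (1 + expect p fun a => if e a then 1 else 0) ^ n := by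
  induction n with
  | zero => simp [expect_iid_zero]
  | succ n ih =>
    have h1 : ∀ b, expect (iid p n)
        (fun l => (2 : ℝ≥0∞) ^ (b :: l).countP (fun a => decide (e a))) =
        (1 + if e b then 1 else 0) *
          (1 + expect p fun a => if e a then 1 else 0) ^ n := by
      intro b
      by_cases hb : e b
      · simp only [hb, List.countP_cons, decide_true, if_true, pow_succ, expect_mul_const, ih]
        rw [mul_comm]
        norm_num
      · simp [hb, ih]
    rw [expect_iid_succ]
    simp_rw [h1]
    rw [expect_mul_const, expect_add, expect_const, pow_succ']

end Iid

/-! ### Symmetrization and uniform convergence -/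

section Symmetrization

variable {A : Type*}

/-- The average of `φ` over all pairs of lists that arise from two lists of the same length by
swapping entries in equal positions. -/
noncomputable def swapAvg : List A → List A → (List A → List A → ℝ≥0∞) → ℝ≥0∞
  | x :: S, y :: S', φ =>
      2⁻¹ * (swapAvg S S' (fun U U' => φ (x :: U) (y :: U')) +
        swapAvg S S' (fun U U' => φ (y :: U) (x :: U')))
  | S, S', φ => φ S S'

/-- The two samples are exchangeable coordinate by coordinate, so each swap preserves the
expectation. -/
theorem expect_swapAvg (p : PMF A) (n : ℕ) (φ : List A → List A → ℝ≥0∞) :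
    expect (iid p n) (fun S => expect (iid p n) fun S' => φ S S') =
      expect (iid p n) fun S => expect (iid p n) fun S' => swapAvg S S' φ := by
  induction n generalizing φ with
  | zero => simp [expect_iid_zero, swapAvg]
  | succ n ih =>
    have key : ∀ ψ : List A → List A → ℝ≥0∞,
        expect (iid p (n + 1)) (fun S => expect (iid p (n + 1)) fun S' => ψ S S') =
          expect p fun x => expect p fun y =>
            expect (iid p n) fun S => expect (iid p n) fun S' => ψ (x :: S) (y :: S') := by
      intro ψ
      simp only [expect_iid_succ]
      congr 1
      funext x
      exact expect_comm _ _ _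
    rw [key, key]
    simp only [swapAvg, expect_const_mul, expect_add, ← ih]
    rw [expect_comm p p (fun a b => expect (iid p n) fun S => expect (iid p n) fun S' =>
      φ (b :: S) (a :: S')), ← two_mul, ← mul_assoc,
      ENNReal.inv_mul_cancel two_ne_zero ENNReal.ofNat_ne_top, one_mul]

/-- Swapping creates no new entries, so a comparison on lists with entries in `W` is enough; `W`
will be the double sample, where a finite cover exists. -/
theorem swapAvg_mono {S S' : List A} {φ ψ : List A → List A → ℝ≥0∞} {W : Set A}
    (hS : ∀ a ∈ S, a ∈ W) (hS' : ∀ a ∈ S', a ∈ W)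
    (h : ∀ U U', (∀ a ∈ U, a ∈ W) → (∀ a ∈ U', a ∈ W) → φ U U' ≤ ψ U U') :
    swapAvg S S' φ ≤ swapAvg S S' ψ := by
  induction S generalizing S' φ ψ with
  | nil => simpa [swapAvg] using h _ _ hS hS'
  | cons x S ih =>
    cases S' with
    | nil => simpa [swapAvg] using h _ _ hS hS'
    | cons y S' =>
      simp only [List.forall_mem_cons] at hS hS'
      simp only [swapAvg]
      gcongr
      · exact ih hS.2 hS'.2 fun U U' hU hU' => h _ _
          (List.forall_mem_cons.2 ⟨hS.1, hU⟩) (List.forall_mem_cons.2 ⟨hS'.1, hU'⟩)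
      · exact ih hS.2 hS'.2 fun U U' hU hU' => h _ _
          (List.forall_mem_cons.2 ⟨hS'.1, hU⟩) (List.forall_mem_cons.2 ⟨hS.1, hU'⟩)

theorem swapAvg_sum {ι : Type*} (R : Finset ι) (S S' : List A)
    (φ : ι → List A → List A → ℝ≥0∞) :
    swapAvg S S' (fun U U' => ∑ i ∈ R, φ i U U') = ∑ i ∈ R, swapAvg S S' (φ i) := by
  induction S generalizing S' φ with
  | nil => simp [swapAvg]
  | cons x S ih =>
    cases S' with
    | nil => simp [swapAvg]
    | cons y S' => simp only [swapAvg, ih, ← Finset.mul_sum, ← Finset.sum_add_distrib]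

theorem swapAvg_const_mul (c : ℝ≥0∞) (S S' : List A) (φ : List A → List A → ℝ≥0∞) :
    swapAvg S S' (fun U U' => c * φ U U') = c * swapAvg S S' φ := by
  induction S generalizing S' φ with
  | nil => simp [swapAvg]
  | cons x S ih =>
    cases S' with
    | nil => simp [swapAvg]
    | cons y S' =>
      simp only [swapAvg, ih]
      ring

open scoped Classical in
/-- `2 ^ (number of errors on U')` if there is no error on `U`, and `0` otherwise. -/
noncomputable def errorWeight (e : A → Prop) (U U' : List A) : ℝ≥0∞ :=
  if ∀ a ∈ U, ¬ e a then 2 ^ U'.countP (fun a => decide (e a)) else 0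

theorem errorWeight_cons (e : A → Prop) (x y : A) (U U' : List A) [Decidable (e x)]
    [Decidable (e y)] :
    errorWeight e (x :: U) (y :: U') =
      (if e x then 0 else if e y then 2 else 1) * errorWeight e U U' := by
  classical
  unfold errorWeight
  by_cases hx : e x
  · simp [hx]
  · by_cases hU : ∀ a ∈ U, ¬ e a
    · by_cases hy : e y
      · simp [hx, hy, pow_succ, mul_comm]
      · simp [hx, hy]
    · simp [hx, hU]

/-- The weight is a product over positions, and each position averages to at most 1: the average is
(0 + 2)/2 if exactly one entry errs, 0 if both do and 1 if neither does. -/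
theorem swapAvg_errorWeight_le (e : A → Prop) {S S' : List A} (h : S.length = S'.length) :
    swapAvg S S' (errorWeight e) ≤ 1 := by
  classical
  induction S generalizing S' with
  | nil =>
    cases S' with
    | nil => simp [swapAvg, errorWeight]
    | cons => simp at h
  | cons x S ih =>
    cases S' with
    | nil => simp at h
    | cons y S' =>
      have := ih (S' := S') (by simpa using h)
      simp only [swapAvg, errorWeight_cons, swapAvg_const_mul, ← add_mul, ← mul_assoc]
      refine mul_le_one' ?_ this
      have h2 : (2 : ℝ≥0∞)⁻¹ * 2 = 1 :=
        ENNReal.inv_mul_cancel two_ne_zero ENNReal.ofNat_ne_top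
      by_cases hx : e x <;> by_cases hy : e y <;> simp [hx, hy, h2, one_add_one_eq_two]

open scoped Classical in
/-- Uniform convergence for consistent hypotheses: if the error patterns of the hypotheses on `2n`
points are covered by `G` hypotheses, then `n` samples exclude, up to probability
`G (1 + η)⁻ⁿ`, all hypotheses of error at least `η`. -/
theorem expect_exists_consistent_le {ι : Type*} (p : PMF A) (n : ℕ) (I : Set ι)
    (e : ι → A → Prop) (G η : ℝ≥0∞)
    (hG : ∀ W : List A, W.length = 2 * n → ∃ R : Finset ι, (R.card : ℝ≥0∞) ≤ G ∧
      ∀ i ∈ I, ∃ r ∈ R, ∀ a ∈ W, e r a ↔ e i a) :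
    expect (iid p n) (fun S => if ∃ i ∈ I, η ≤ expect p (fun a => if e i a then 1 else 0) ∧
        ∀ a ∈ S, ¬ e i a then 1 else 0) * (1 + η) ^ n ≤ G := by
  -- A consistent hypothesis of error at least η forces the ghost mean of Ψ up to (1 + η)ⁿ. On a
  -- fixed double sample, the swap average of Ψ is at most the size of the cover.
  set Ψ : List A → List A → ℝ≥0∞ := fun U U' => ⨆ i ∈ I, errorWeight (e i) U U'
  calc _ ≤ expect (iid p n) (fun S => expect (iid p n) fun S' => Ψ S S') := by
        rw [← expect_mul_const]
        refine expect_mono _ fun S => ?_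
        split_ifs with h
        · obtain ⟨i, hi, hη, hS⟩ := h
          rw [one_mul]
          calc (1 + η) ^ n ≤ (1 + expect p fun a => if e i a then 1 else 0) ^ n := by gcongr
            _ = _ := (expect_iid_two_pow_countP p n (e i)).symm
            _ ≤ _ := expect_mono _ fun S' => by
              refine le_trans ?_ (le_iSup₂ (f := fun i _ => errorWeight (e i) S S') i hi)
              simp only [errorWeight]
              rw [if_pos hS]
        · simp
    _ = expect (iid p n) (fun S => expect (iid p n) fun S' => swapAvg S S' Ψ) :=
        expect_swapAvg p n Ψ
    _ ≤ G := by
        refine expect_le_of_support _ fun S hS => expect_le_of_support _ fun S' hS' => ?_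
        have hl := (mem_support_iid hS).1
        have hl' := (mem_support_iid hS').1
        obtain ⟨R, hR, hcov⟩ := hG (S ++ S') (by simp [hl, hl']; ring)
        calc swapAvg S S' Ψ ≤ swapAvg S S' (fun U U' => ∑ r ∈ R, errorWeight (e r) U U') := by
              refine swapAvg_mono (W := {a | a ∈ S ++ S'}) (fun a ha => by simp [ha])
                (fun a ha => by simp [ha]) fun U U' hU hU' => ?_
              refine iSup₂_le fun i hi => ?_
              obtain ⟨r, hr, hri⟩ := hcov i hi
              refine le_trans (le_of_eq ?_)
                (Finset.single_le_sum (f := fun r => errorWeight (e r) U U')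
                  (fun _ _ => zero_le) hr)
              unfold errorWeight
              have h1 : (∀ a ∈ U, ¬ e i a) ↔ ∀ a ∈ U, ¬ e r a :=
                forall₂_congr fun a ha => not_congr (hri a (hU a ha)).symm
              have h2 : U'.countP (fun a => decide (e i a)) =
                  U'.countP (fun a => decide (e r a)) :=
                List.countP_congr fun a ha => by simpa using (hri a (hU' a ha)).symm
              simp only [h1, h2]
          _ = ∑ r ∈ R, swapAvg S S' (errorWeight (e r)) := swapAvg_sum _ _ _ _
          _ ≤ ∑ r ∈ R, 1 := Finset.sum_le_sum fun r _ =>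
              swapAvg_errorWeight_le _ (hl.trans hl'.symm)
          _ ≤ G := by simpa using hR

end Symmetrization

/-! ### Covering numbers of classes of finite Natarajan dimension -/

section Natarajan

variable {A B : Type*}

/-- If the functions of `F` with value `y` at `a` that agree on `S` with a function of `F` with
value `y' ≠ y` at `a` shatter `S' ⊆ S`, then `F` shatters `S' ∪ {a}`. -/
theorem NatarajanShatters.insert [DecidableEq A] {F : Set (A → B)} {S S' : Finset A} {a : A}
    (ha : a ∉ S) (hS' : S' ⊆ S) {y y' : B} (hy : y ≠ y')
    (h : NatarajanShatters {h ∈ F | h a = y ∧ ∃ h' ∈ F, h' a = y' ∧ ∀ b ∈ S, h' b = h b} S') :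
    NatarajanShatters F (insert a S') := by
  obtain ⟨f, g, hfg, hR⟩ := h
  have hne : ∀ b ∈ S', b ≠ a := fun b hb hba => ha (hba ▸ hS' hb)
  refine ⟨Function.update f a y, Function.update g a y', ?_, fun R hRS => ?_⟩
  · intro b hb
    rcases Finset.mem_insert.1 hb with rfl | hb
    · simpa using hy
    · simpa [hne b hb] using hfg b hb
  · obtain ⟨h, ⟨hF, hay, h', hF', hay', hh'⟩, h1, h2⟩ := hR (R.erase a) fun b hb => by
      rw [Finset.mem_erase] at hb
      exact (Finset.mem_insert.1 (hRS hb.2)).resolve_left hb.1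
    have h3 : ∀ b ∈ R, b ≠ a → h b = f b := fun b hb hba => h1 b (Finset.mem_erase.2 ⟨hba, hb⟩)
    -- At `a` the pattern selects `y` or `y'`: the function `h` realizes the first, its twin `h'`
    -- the second, and they agree on `S`.
    by_cases haR : a ∈ R
    · refine ⟨h, hF, fun b hb => ?_, fun b hb hbR => ?_⟩
      · by_cases hba : b = a
        · simp [hba, hay]
        · simp [hba, h3 b hb hba]
      · have hba : b ≠ a := fun hba => hbR (hba ▸ haR)
        have hbS := (Finset.mem_insert.1 hb).resolve_left hba
        simp [hba, h2 b hbS fun hb' => hbR (Finset.mem_of_mem_erase hb')]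
    · refine ⟨h', hF', fun b hb => ?_, fun b hb hbR => ?_⟩
      · have hba : b ≠ a := fun hba => haR (hba ▸ hb)
        have hbS := (Finset.mem_insert.1 (hRS hb)).resolve_left hba
        simp [hba, hh' b (hS' hbS), h3 b hb hba]
      · rcases Finset.mem_insert.1 hb with rfl | hbS
        · simp [hay']
        · simp [hne b hbS, hh' b (hS' hbS),
            h2 b hbS fun hb' => hbR (Finset.mem_of_mem_erase hb')]

theorem natarajanShatters_empty {F : Set (A → B)} (hF : F.Nonempty) : NatarajanShatters F ∅ := by
  obtain ⟨f, hf⟩ := hF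
  exact ⟨f, f, by simp, fun R hR => ⟨f, hf, by simp, by simp⟩⟩

/-- Natarajan's lemma, for coverings: a class of Natarajan dimension `d` is covered on a finite set
`S` by `x⁻ᵈ (1 + x |B|²)^|S|` of its functions, for every `0 < x ≤ 1`. -/
theorem exists_cover_of_natarajanShatters [DecidableEq A] [Fintype B] {x : ℝ} (hx0 : 0 < x)
    (hx1 : x ≤ 1) (S : Finset A) (F : Set (A → B)) (d : ℕ)
    (hd : ∀ S' ⊆ S, NatarajanShatters F S' → S'.card ≤ d) :
    ∃ R : Finset (A → B), (R : Set (A → B)) ⊆ F ∧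
      (R.card : ℝ) ≤ x⁻¹ ^ d * (1 + x * (Fintype.card B : ℝ) ^ 2) ^ S.card ∧
      ∀ h ∈ F, ∃ r ∈ R, ∀ a ∈ S, r a = h a := by
  classical
  induction S using Finset.induction_on generalizing F d with
  | empty =>
    rcases F.eq_empty_or_nonempty with rfl | ⟨f, hf⟩
    · exact ⟨∅, by simp, by simp; positivity, by simp⟩
    · refine ⟨{f}, by simpa using hf, ?_, fun h _ => ⟨f, by simp, by simp⟩⟩
      simpa using one_le_pow₀ (one_le_inv₀ hx0 |>.2 hx1)
  | insert a S ha ih =>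
    set Q : ℝ := x⁻¹ ^ d * (1 + x * (Fintype.card B : ℝ) ^ 2) ^ S.card with hQ
    have hQ0 : 0 ≤ Q := by positivity
    obtain ⟨R₀, hR₀F, hR₀c, hR₀⟩ := ih F d fun S' hS' hsh =>
      hd S' (hS'.trans (Finset.subset_insert _ _)) hsh
    -- For each ordered pair of distinct values, the functions having a twin at `a` form a class of
    -- dimension at most d - 1. Lowering the exponent of x⁻¹ by one gives the factor x, so all pairs
    -- together cost at most |B|² x Q.
    have hpair : ∀ p : B × B, ∃ R : Finset (A → B), (R : Set (A → B)) ⊆ F ∧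
        (R.card : ℝ) ≤ x * Q ∧ (p.1 ≠ p.2 → ∀ h ∈ F, h a = p.1 →
          (∃ h' ∈ F, h' a = p.2 ∧ ∀ b ∈ S, h' b = h b) →
          ∃ r ∈ R, r a = p.1 ∧ ∀ b ∈ S, r b = h b) := by
      rintro ⟨y, y'⟩
      by_cases hy : y = y'
      · exact ⟨∅, by simp, by simp; positivity, fun h => absurd hy h⟩
      set F' : Set (A → B) := {h ∈ F | h a = y ∧ ∃ h' ∈ F, h' a = y' ∧ ∀ b ∈ S, h' b = h b}
      have hsh : ∀ S' ⊆ S, NatarajanShatters F' S' → S'.card + 1 ≤ d := fun S' hS' h => by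
        have := hd _ (Finset.insert_subset_insert a hS') (h.insert ha hS' hy)
        rwa [Finset.card_insert_of_notMem fun h => ha (hS' h)] at this
      rcases F'.eq_empty_or_nonempty with hF' | hF'
      · refine ⟨∅, by simp, by simp; positivity, fun _ h hF hay hh' => ?_⟩
        have : h ∈ F' := ⟨hF, hay, hh'⟩
        simp [hF'] at this
      -- A nonempty class shatters ∅, so the existence of twins already forces d ≥ 1.
      · obtain ⟨e, rfl⟩ : ∃ e, d = e + 1 :=
          ⟨d - 1, by have := hsh ∅ (by simp) (natarajanShatters_empty hF'); omega⟩
        obtain ⟨R, hRF, hRc, hR⟩ := ih F' e fun S' hS' h => by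
          have := hsh S' hS' h
          omega
        refine ⟨R, fun r hr => (hRF hr).1, hRc.trans_eq ?_, fun _ h hF hay hh' => ?_⟩
        · rw [hQ, pow_succ]
          linear_combination (-(x⁻¹ ^ e * (1 + x * (Fintype.card B : ℝ) ^ 2) ^ S.card)) *
            mul_inv_cancel₀ hx0.ne'
        · obtain ⟨r, hr, hrS⟩ := hR h ⟨hF, hay, hh'⟩
          exact ⟨r, hr, (hRF hr).2.1, hrS⟩
    choose Rp hRpF hRpc hRp using hpair
    refine ⟨R₀ ∪ Finset.univ.biUnion Rp, ?_, ?_, fun h hF => ?_⟩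
    · intro r hr
      simp only [Finset.coe_union, Set.mem_union, Finset.mem_coe, Finset.mem_biUnion,
        Finset.mem_univ, true_and] at hr
      rcases hr with hr | ⟨p, hr⟩
      exacts [hR₀F hr, hRpF p hr]
    · calc ((R₀ ∪ Finset.univ.biUnion Rp).card : ℝ)
          ≤ R₀.card + ∑ p, ((Rp p).card : ℝ) := by
            exact_mod_cast (Finset.card_union_le _ _).trans
              (Nat.add_le_add_left Finset.card_biUnion_le _)
        _ ≤ Q + ∑ _p : B × B, x * Q := by
            gcongr with p
            exact hRpc p
        _ = x⁻¹ ^ d * (1 + x * (Fintype.card B : ℝ) ^ 2) ^ (insert a S).card := by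
            rw [Finset.card_insert_of_notMem ha, hQ]
            simp only [Finset.sum_const, Finset.card_univ, Fintype.card_prod, nsmul_eq_mul]
            push_cast
            ring
    · obtain ⟨r₀, hr₀, h₀⟩ := hR₀ h hF
      -- If `r₀` is wrong at `a`, it is itself a twin of `h`. This is why the cover must consist of
      -- members of `F`.
      by_cases hay : r₀ a = h a
      · exact ⟨r₀, by simp [hr₀], by simpa [hay] using h₀⟩
      · obtain ⟨r, hr, hra, hrS⟩ := hRp (h a, r₀ a) (Ne.symm hay) h hF rfl
          ⟨r₀, hR₀F hr₀, rfl, h₀⟩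
        refine ⟨r, ?_, by simpa [hra] using hrS⟩
        simp only [Finset.mem_union, Finset.mem_biUnion, Finset.mem_univ, true_and]
        exact Or.inr ⟨_, hr⟩

theorem NatarajanShatters.card_le {F : Set (A → B)} {S : Finset A} (h : NatarajanShatters F S)
    {d : ℕ} (hd : natarajanDim F = d) : S.card ≤ d := by
  have : (S.card : ℕ∞) ≤ natarajanDim F :=
    le_iSup₂ (f := fun (S : Finset A) (_ : NatarajanShatters F S) => (S.card : ℕ∞)) S h
  rw [hd] at this
  exact_mod_cast this

end Natarajan

/-! ### Covering of chains of thought -/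

section Cot

variable {Tok : Type*}

theorem generated_eq_take (π : Model Tok) (x : List Tok) {T t : ℕ} (ht : t ≤ T) :
    generated π x t = (List.ofFn (cot π T x)).take t := by
  induction t with
  | zero => rfl
  | succ t ih =>
    rw [generated, ih (by omega), List.take_add_one, List.getElem?_eq_getElem (by simp; omega)]
    simp [cot, ih (show t ≤ T by omega)]

theorem generated_congr {π π' : Model Tok} {x : List Tok} {T : ℕ}
    (h : ∀ t < T, π (x ++ generated π x t) = π' (x ++ generated π x t)) {t : ℕ} (ht : t ≤ T) :
    generated π' x t = generated π x t := by
  induction t with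
  | zero => rfl
  | succ t ih => rw [generated, generated, ih (by omega), h t ht]

theorem cot_congr {π π' : Model Tok} {x : List Tok} {T : ℕ}
    (h : ∀ t < T, π (x ++ generated π x t) = π' (x ++ generated π x t)) :
    cot π' T x = cot π T x := by
  funext t
  simp only [cot]
  rw [generated_congr h t.2.le, h t t.2]

/-- The prefixes, with the prompt `x` in front, of the responses in `Y`. -/
def prefixes [DecidableEq Tok] {T : ℕ} (x : List Tok) (Y : Finset (Response Tok T)) :
    Finset (List Tok) :=
  (Y ×ˢ Finset.range T).image fun q => x ++ (List.ofFn q.1).take q.2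

/-- Generation by `π` only queries prefixes of its own chain; since that chain lies in `Y`, the
model `π'` is led along the same path. -/
theorem cot_eq_of_eqOn_prefixes [DecidableEq Tok] {T : ℕ} {π π' : Model Tok} {x : List Tok}
    {Y : Finset (Response Tok T)} (h : ∀ l ∈ prefixes x Y, π l = π' l) (hY : cot π T x ∈ Y) :
    cot π' T x = cot π T x := by
  refine cot_congr fun t ht => h _ ?_
  rw [generated_eq_take π x ht.le]
  exact Finset.mem_image.2 ⟨(cot π T x, t), by simp [hY, ht], rfl⟩

theorem card_prefixes_le [DecidableEq Tok] {T : ℕ} (x : List Tok) (Y : Finset (Response Tok T)) :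
    (prefixes x Y).card ≤ Y.card * T :=
  Finset.card_image_le.trans_eq (by simp)

open scoped Classical in
/-- The responses to which the reference model gives probability at least `c`. -/
noncomputable def covered {X : Set (List Tok)} {T : ℕ} [Fintype Tok]
    (πref : X → PMF (Response Tok T)) (c : ℝ≥0∞) (x : X) : Finset (Response Tok T) :=
  Finset.univ.filter fun y => c ≤ πref x y

/-- The covered responses share a total mass of 1, so coverage, not |Σ|^T, controls their number. -/
theorem card_covered_mul_le {X : Set (List Tok)} {T : ℕ} [Fintype Tok]
    (πref : X → PMF (Response Tok T)) (c : ℝ≥0∞) (x : X) :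
    ((covered πref c x).card : ℝ≥0∞) * c ≤ 1 := by
  classical
  calc ((covered πref c x).card : ℝ≥0∞) * c = ∑ _y ∈ covered πref c x, c := by simp
    _ ≤ ∑ y ∈ covered πref c x, πref x y :=
        Finset.sum_le_sum fun y hy => by simpa [covered] using hy
    _ ≤ ∑' y, πref x y := ENNReal.sum_le_tsum _
    _ = 1 := (πref x).tsum_coe

theorem card_covered_le {X : Set (List Tok)} {T : ℕ} [Fintype Tok]
    (πref : X → PMF (Response Tok T)) {C : ℝ} (hC : 0 < C) (x : X) :
    ((covered πref (ENNReal.ofReal C⁻¹) x).card : ℝ) ≤ C := by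
  have h := card_covered_mul_le πref (ENNReal.ofReal C⁻¹) x
  rw [← ENNReal.ofReal_natCast, ← ENNReal.ofReal_mul (by positivity), ENNReal.ofReal_le_one] at h
  rwa [← div_eq_mul_inv, div_le_one hC] at h

/-- The model `π` does not give a covered response to `x`, or its answer is rejected. -/
def Fails {X : Set (List Tok)} {T : ℕ} [NeZero T] (V : X → Tok → Bool)
    (πref : X → PMF (Response Tok T)) (c : ℝ≥0∞) (π : Model Tok) (x : X) : Prop :=
  ¬ (c ≤ πref x (cot π T x) ∧ V x (modelAnswer π T x) = true)

theorem not_fails_congr {X : Set (List Tok)} {T : ℕ} [NeZero T] [Fintype Tok] [DecidableEq Tok]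
    {V : X → Tok → Bool} {πref : X → PMF (Response Tok T)} {c : ℝ≥0∞} {π π' : Model Tok} {x : X}
    (h : ∀ l ∈ prefixes x.1 (covered πref c x), π l = π' l) (hπ : ¬ Fails V πref c π x) :
    ¬ Fails V πref c π' x := by
  classical
  simp only [Fails, not_not, modelAnswer] at hπ ⊢
  rwa [cot_eq_of_eqOn_prefixes h (by simpa [covered] using hπ.1)]

/-- The patterns of failures on a list of prompts are covered by few models. -/
theorem exists_cover_fails {X : Set (List Tok)} {T : ℕ} [NeZero T] [Fintype Tok] [DecidableEq Tok]
    (V : X → Tok → Bool) (πref : X → PMF (Response Tok T)) {C : ℝ} (hC : 0 < C)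
    {Pi : Set (Model Tok)} {d : ℕ} (hd : natarajanDim Pi = d) {x : ℝ} (hx0 : 0 < x) (hx1 : x ≤ 1)
    (W : List X) :
    ∃ R : Finset (Model Tok),
      (R.card : ℝ) ≤ x⁻¹ ^ d * Real.exp (x * (Fintype.card Tok : ℝ) ^ 2 * (W.length * (C * T))) ∧
      ∀ π ∈ Pi, ∃ r ∈ R, ∀ a ∈ W,
        Fails V πref (ENNReal.ofReal C⁻¹) r a ↔ Fails V πref (ENNReal.ofReal C⁻¹) π a := by
  classical
  set P : X → Finset (List Tok) := fun a => prefixes a.1 (covered πref (ENNReal.ofReal C⁻¹) a)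
  set S : Finset (List Tok) := W.toFinset.biUnion P
  have hS : (S.card : ℝ) ≤ W.length * (C * T) := by
    calc (S.card : ℝ) ≤ ∑ a ∈ W.toFinset, ((P a).card : ℝ) := by
          exact_mod_cast Finset.card_biUnion_le
      _ ≤ ∑ _a ∈ W.toFinset, C * T := Finset.sum_le_sum fun a _ => by
          calc ((P a).card : ℝ) ≤
                ((covered πref (ENNReal.ofReal C⁻¹) a).card : ℝ) * T := by
                exact_mod_cast card_prefixes_le _ _
            _ ≤ C * T := by
                gcongr
                exact card_covered_le πref hC a
      _ = W.toFinset.card * (C * T) := by simp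
      _ ≤ _ := by
          gcongr
          exact W.toFinset_card_le
  obtain ⟨R, -, hRc, hR⟩ :=
    exists_cover_of_natarajanShatters hx0 hx1 S Pi d fun S' _ h => h.card_le hd
  refine ⟨R, hRc.trans ?_, fun π hπ => ?_⟩
  · gcongr
    calc (1 + x * (Fintype.card Tok : ℝ) ^ 2) ^ S.card
        ≤ Real.exp (x * (Fintype.card Tok : ℝ) ^ 2) ^ S.card := by
          gcongr
          rw [add_comm]
          exact Real.add_one_le_exp _
      _ = Real.exp (x * (Fintype.card Tok : ℝ) ^ 2 * S.card) := by
          rw [← Real.exp_nat_mul, mul_comm]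
      _ ≤ _ := by gcongr
  · obtain ⟨r, hr, hrS⟩ := hR π hπ
    refine ⟨r, hr, fun a ha => ?_⟩
    have hP : ∀ l ∈ P a, r l = π l := fun l hl =>
      hrS l (Finset.mem_biUnion.2 ⟨a, by simpa using ha, hl⟩)
    -- Agreement is only known on covered prefixes, so it is success that transfers, in both
    -- directions.
    exact not_iff_not.1 ⟨not_fails_congr hP, not_fails_congr fun l hl => (hP l hl).symm⟩

end Cot

/-! ### The base learner -/

section BaseLearner

variable {Tok : Type*} {X : Set (List Tok)} {T : ℕ}

/-- Some model of the class has zero loss, whereas a single miss would cost the minimizer at least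
1/|S|. -/
theorem IsERM.cot_mem {Pi : Set (Model Tok)}
    {erm : List (X × Set (Response Tok T)) → Model Tok} (h : IsERM Pi erm) {π : Model Tok}
    (hπ : π ∈ Pi) {S : List (X × Set (Response Tok T))} (hS : ∀ s ∈ S, cot π T s.1 ∈ s.2) :
    ∀ s ∈ S, cot (erm S) T s.1 ∈ s.2 := by
  classical
  intro s hs
  by_contra hns
  have h1 := (h S).2 π hπ
  have h2 : empiricalLoss S π = 0 := by
    unfold empiricalLoss
    rw [List.sum_eq_zero, mul_zero]
    intro z hz
    obtain ⟨s, hs, rfl⟩ := List.mem_map.1 hz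
    simp [hS s hs]
  have h3 : (1 : ℝ) ≤ (S.map fun s => if cot (erm S) T s.1 ∈ s.2 then (0 : ℝ) else 1).sum := by
    refine List.single_le_sum (fun z hz => ?_) _ (List.mem_map.2 ⟨s, hs, by simp [hns]⟩)
    obtain ⟨s, -, rfl⟩ := List.mem_map.1 hz
    split_ifs <;> simp
  have h4 : 0 < S.length := List.length_pos_of_mem hs
  have h5 : 0 < empiricalLoss S (erm S) := by
    unfold empiricalLoss
    have : (0 : ℝ) < S.length := by exact_mod_cast h4
    have : (0 : ℝ) < 1 / S.length := by positivity
    convert mul_pos this (zero_lt_one.trans_le h3)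
  linarith

variable [NeZero T]

open scoped Classical in
theorem expect_notMem_keptResponses (V : X → Tok → Bool) (πref : X → PMF (Response Tok T))
    {C : ℝ} (m : ℕ) {x : X} {y : Response Tok T} (hy : ENNReal.ofReal C⁻¹ ≤ πref x y)
    (hV : V x (answer y) = true) :
    expect (iid (πref x) m) (fun ys => if y ∈ keptResponses V πref C x ys then 0 else 1) ≤
      (1 - ENNReal.ofReal C⁻¹) ^ m := by
  have : ∀ ys, y ∈ keptResponses V πref C x ys ↔ y ∈ ys := fun ys => by
    simp [keptResponses, hy, hV]
  simp only [this, expect_iid_notMem]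
  gcongr

open scoped Classical in
theorem expect_labelled_le (V : X → Tok → Bool) (πref : X → PMF (Response Tok T))
    {C : ℝ} (m : ℕ) (π : Model Tok) (l : List X)
    (hl : ∀ x ∈ l, ENNReal.ofReal C⁻¹ ≤ πref x (cot π T x) ∧ V x (modelAnswer π T x) = true) :
    expect (labelled V πref C m l) (fun S => if ∃ s ∈ S, cot π T s.1 ∉ s.2 then 1 else 0) ≤
      l.length * (1 - ENNReal.ofReal C⁻¹) ^ m := by
  induction l with
  | nil => simp [labelled, expect_pure]
  | cons x l ih =>
    simp only [List.forall_mem_cons] at hl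
    simp only [labelled, expect_bind, expect_pure]
    calc _ ≤ expect (iid (πref x) m) (fun ys =>
            (if cot π T x ∈ keptResponses V πref C x ys then 0 else 1) +
            expect (labelled V πref C m l)
              (fun S => if ∃ s ∈ S, cot π T s.1 ∉ s.2 then 1 else 0)) := by
          refine expect_mono _ fun ys => ?_
          rw [← expect_const (labelled V πref C m l)
            (if cot π T x ∈ keptResponses V πref C x ys then 0 else 1), ← expect_add]
          refine expect_mono _ fun S => ?_
          by_cases h1 : cot π T x ∈ keptResponses V πref C x ys <;> simp [h1]
      _ ≤ (1 - ENNReal.ofReal C⁻¹) ^ m + l.length * (1 - ENNReal.ofReal C⁻¹) ^ m := by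
          rw [expect_add, expect_const]
          exact add_le_add (expect_notMem_keptResponses V πref m hl.1.1 hl.1.2) (ih hl.2)
      _ = _ := by
          simp only [List.length_cons, Nat.cast_add, Nat.cast_one]
          ring

/-- This sure property of the filter turns membership in the kept sets into the absence of failures,
independently of the drawn responses. -/
theorem mem_support_labelled {V : X → Tok → Bool} {πref : X → PMF (Response Tok T)}
    {C : ℝ} {m : ℕ} {l : List X} {S : List (X × Set (Response Tok T))}
    (hS : S ∈ (labelled V πref C m l).support) :
    (∀ x ∈ l, ∃ s ∈ S, s.1 = x) ∧ ∀ s ∈ S, ∀ y ∈ s.2,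
      ENNReal.ofReal C⁻¹ ≤ πref s.1 y ∧ V s.1 (answer y) = true := by
  induction l generalizing S with
  | nil => simp_all [labelled]
  | cons x l ih =>
    simp only [labelled, PMF.mem_support_bind_iff, PMF.mem_support_pure_iff] at hS
    obtain ⟨ys, -, S, hS, rfl⟩ := hS
    obtain ⟨h1, h2⟩ := ih hS
    refine ⟨?_, ?_⟩
    · intro z hz
      rcases List.mem_cons.1 hz with rfl | hz
      · exact ⟨_, List.mem_cons_self, rfl⟩
      · obtain ⟨s, hs, hsz⟩ := h1 z hz
        exact ⟨s, List.mem_cons_of_mem _ hs, hsz⟩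
    · intro s hs
      rcases List.mem_cons.1 hs with rfl | hs
      · exact fun y hy => hy.2
      · exact h2 s hs

/-- The indicator that `π` answers `x` incorrectly. -/
noncomputable def errInd (T : ℕ) [NeZero T] (V : X → Tok → Bool) (π : Model Tok) (x : X) :
    ℝ≥0∞ :=
  if V x (modelAnswer π T x) = true then 0 else 1

open scoped Classical in
theorem errInd_le (V : X → Tok → Bool) (πref : X → PMF (Response Tok T)) (c : ℝ≥0∞)
    (π : Model Tok) (x : X) :
    errInd T V π x ≤ if Fails V πref c π x then 1 else 0 := by
  by_cases h : V x (modelAnswer π T x) = true <;> simp [errInd, Fails, h]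

open scoped Classical in
theorem expect_rlFineTune_le (V : X → Tok → Bool) (πref : X → PMF (Response Tok T)) {C : ℝ}
    {Pi : Set (Model Tok)} {erm : List (X × Set (Response Tok T)) → Model Tok}
    (herm : IsERM Pi erm) {πstar : Model Tok} (hstar : πstar ∈ Pi) (δ : ℝ) (μ : PMF X)
    (η : ℝ≥0∞) (l : List X)
    (hl : ∀ x ∈ l, ENNReal.ofReal C⁻¹ ≤ πref x (cot πstar T x) ∧
      V x (modelAnswer πstar T x) = true) :
    expect (rlFineTune V πref C erm δ l)
        (fun b => if η ≤ expect μ (errInd T V b.1) then 1 else 0) ≤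
      l.length * (1 - ENNReal.ofReal C⁻¹) ^ rolloutsPerPrompt C δ l.length +
        if ∃ π ∈ Pi, η ≤ expect μ
            (fun a => if Fails V πref (ENNReal.ofReal C⁻¹) π a then 1 else 0) ∧
          ∀ a ∈ l, ¬ Fails V πref (ENNReal.ofReal C⁻¹) π a then 1 else 0 := by
  simp only [rlFineTune, expect_bind, expect_pure]
  refine le_trans ?_ (add_le_add_left (expect_labelled_le V πref _ πstar l hl) _)
  rw [← expect_const (labelled V πref C (rolloutsPerPrompt C δ l.length) l) (ite _ _ _),
    ← expect_add]
  refine expect_mono_support _ fun S hS => ?_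
  by_cases hη : η ≤ expect μ (errInd T V (erm S))
  · by_cases hk : ∃ s ∈ S, cot πstar T s.1 ∉ s.2
    · simp [hη, hk]
    · push Not at hk
      obtain ⟨h1, h2⟩ := mem_support_labelled hS
      have h3 : ∀ a ∈ l, ¬ Fails V πref (ENNReal.ofReal C⁻¹) (erm S) a := fun a ha => by
        obtain ⟨s, hs, rfl⟩ := h1 a ha
        exact not_not.2 (h2 s hs _ (herm.cot_mem hstar hk s hs))
      rw [if_pos hη]
      exact le_add_left (if_pos ⟨erm S, (herm S).1, hη.trans (expect_mono _ fun x =>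
        errInd_le V πref _ _ x), h3⟩).ge
  · simp [hη]

/-- With m ≥ C log(4NC/δ) draws, (1 - 1/C)^m ≤ exp(-m/C) ≤ δ/(4NC); the rest is a union bound over
the prompts. -/
theorem mul_one_sub_inv_pow_rollouts_le {C δ : ℝ} (hC : 1 ≤ C) (hδ : 0 < δ) {N : ℕ}
    (hN : 1 ≤ N) :
    (N : ℝ≥0∞) * (1 - ENNReal.ofReal C⁻¹) ^ rolloutsPerPrompt C δ N ≤ ENNReal.ofReal (δ / 4) := by
  have hC0 : 0 < C := by linarith
  have hC1 : C⁻¹ ≤ 1 := inv_le_one_of_one_le₀ hC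
  have hN0 : (0 : ℝ) < N := by exact_mod_cast hN
  rw [← ENNReal.ofReal_one, ← ENNReal.ofReal_sub _ (by positivity),
    ← ENNReal.ofReal_pow (by linarith), ← ENNReal.ofReal_natCast,
    ← ENNReal.ofReal_mul (by positivity)]
  apply ENNReal.ofReal_le_ofReal
  set m := rolloutsPerPrompt C δ N
  have h1 : Real.log (4 * N * C / δ) ≤ C⁻¹ * m := by
    rw [inv_mul_eq_div, le_div_iff₀ hC0, mul_comm]
    exact Nat.le_ceil _
  calc (N : ℝ) * (1 - C⁻¹) ^ m ≤ N * Real.exp (-C⁻¹) ^ m := by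
        gcongr
        linarith [Real.add_one_le_exp (-C⁻¹)]
    _ = N * Real.exp (-(C⁻¹ * m)) := by
        rw [← Real.exp_nat_mul]
        ring_nf
    _ ≤ N * Real.exp (-Real.log (4 * N * C / δ)) := by gcongr
    _ = δ / 4 * C⁻¹ := by
        rw [Real.exp_neg, Real.exp_log (by positivity)]
        field_simp
    _ ≤ δ / 4 := mul_le_of_le_one_right (by positivity) hC1

open scoped Classical in
/-- The guarantee of `RLFineTune` for error level `1 / 4`. -/
theorem expect_iid_rlFineTune_le [Fintype Tok] [DecidableEq Tok] (V : X → Tok → Bool)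
    (πref : X → PMF (Response Tok T)) {C : ℝ} (hC : 1 ≤ C)
    {Pi : Set (Model Tok)} {d : ℕ} (hd : natarajanDim Pi = d)
    {erm : List (X × Set (Response Tok T)) → Model Tok}
    (herm : IsERM Pi erm) {πstar : Model Tok} (hstar : πstar ∈ Pi) {δ : ℝ} (hδ : 0 < δ)
    (μ : PMF X) (hμ : ∀ x ∈ μ.support, ENNReal.ofReal C⁻¹ ≤ πref x (cot πstar T x) ∧
      V x (modelAnswer πstar T x) = true) {N : ℕ} (hN1 : 1 ≤ N)
    (hN : d * Real.log (20 * (Fintype.card Tok) ^ 2 * C * T) + Real.log (4 / δ) ≤ N / 10) :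
    expect (iid μ N) (fun l => expect (rlFineTune V πref C erm δ l)
        (fun b => if ENNReal.ofReal (1 / 4) ≤ expect μ (errInd T V b.1) then 1 else 0)) ≤
      ENNReal.ofReal (δ / 2) := by
  have hs : (1 : ℝ) ≤ Fintype.card Tok := by
    exact_mod_cast Fintype.card_pos_iff.2 ⟨πstar []⟩
  have hT : (1 : ℝ) ≤ T := by exact_mod_cast NeZero.one_le
  have hN0 : (0 : ℝ) < N := by exact_mod_cast hN1
  set s : ℝ := (Fintype.card Tok : ℝ)
  -- Taking x = 1/K, the cover on 2N prompts has exponent x s² · 2N · C T = N/10, half of the gain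
  -- e^{N/5} ≤ (5/4)^N. The other half absorbs K^d and 4/δ.
  set K : ℝ := 20 * s ^ 2 * C * T with hK
  have hK1 : 1 ≤ K := by
    have : 1 ≤ s ^ 2 := one_le_pow₀ hs
    have h2 : 1 ≤ s ^ 2 * C * T :=
      one_le_mul_of_one_le_of_one_le (one_le_mul_of_one_le_of_one_le this hC) hT
    nlinarith
  have hK0 : 0 < K := by linarith
  set G : ℝ := K ^ d * Real.exp (N / 10) with hG
  have hunif := expect_exists_consistent_le μ N Pi (Fails V πref (ENNReal.ofReal C⁻¹))
    (ENNReal.ofReal G) (ENNReal.ofReal (1 / 4)) fun W hW => by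
      obtain ⟨R, hR, hcov⟩ := exists_cover_fails V πref (zero_lt_one.trans_le hC) hd
        (inv_pos.2 hK0) (inv_le_one_of_one_le₀ hK1) W
      refine ⟨R, ?_, hcov⟩
      rw [← ENNReal.ofReal_natCast]
      refine ENNReal.ofReal_le_ofReal (hR.trans_eq ?_)
      rw [inv_inv, hG]
      congr 2
      rw [hW]
      change K⁻¹ * s ^ 2 * _ = _
      push_cast
      field_simp
      rw [hK]
      ring
  have hexp : G * Real.exp (-(N / 5)) ≤ δ / 4 := by
    have : K ^ d = Real.exp (d * Real.log K) := by
      rw [Real.exp_nat_mul, Real.exp_log hK0]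
    rw [hG, this, ← Real.exp_add, ← Real.exp_add,
      show δ / 4 = Real.exp (-Real.log (4 / δ)) by
        rw [Real.exp_neg, Real.exp_log (by positivity), inv_div]]
    apply Real.exp_le_exp.2
    linarith
  have hpow : Real.exp (N / 5) ≤ (1 + 1 / 4 : ℝ) ^ N := by
    have h1 : Real.exp (1 / 5) ≤ 1 + 1 / 4 := by
      have h2 := Real.add_one_le_exp (-(1 / 5) : ℝ)
      rw [Real.exp_neg] at h2
      have h3 := Real.exp_pos (1 / 5)
      rw [← inv_inv (Real.exp (1 / 5))]
      rw [show (1 + 1 / 4 : ℝ) = (4 / 5)⁻¹ by norm_num]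
      gcongr
      linarith
    calc Real.exp (N / 5) = Real.exp (1 / 5) ^ N := by
          rw [← Real.exp_nat_mul]
          ring_nf
      _ ≤ _ := by gcongr
  have hP : ∀ P : ℝ≥0∞, P * (1 + ENNReal.ofReal (1 / 4)) ^ N ≤ ENNReal.ofReal G →
      P ≤ ENNReal.ofReal (δ / 4) := by
    intro P h
    have h1 : (1 + ENNReal.ofReal (1 / 4)) ^ N = ENNReal.ofReal ((1 + 1 / 4) ^ N) := by
      rw [ENNReal.ofReal_pow (by norm_num), ENNReal.ofReal_add (by norm_num) (by norm_num),
        ENNReal.ofReal_one]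
    calc P ≤ ENNReal.ofReal G / ENNReal.ofReal ((1 + 1 / 4) ^ N) := by
          rw [← h1]
          exact (ENNReal.le_div_iff_mul_le (Or.inl (by simp)) (Or.inl (by simp))).2 h
      _ = ENNReal.ofReal (G / (1 + 1 / 4) ^ N) :=
          (ENNReal.ofReal_div_of_pos (by positivity)).symm
      _ ≤ _ := by
          refine ENNReal.ofReal_le_ofReal (le_trans ?_ hexp)
          rw [Real.exp_neg, div_eq_mul_inv]
          gcongr
  calc _ ≤ expect (iid μ N) (fun l =>
          (N : ℝ≥0∞) * (1 - ENNReal.ofReal C⁻¹) ^ rolloutsPerPrompt C δ N +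
            if ∃ π ∈ Pi, ENNReal.ofReal (1 / 4) ≤ expect μ
                (fun a => if Fails V πref (ENNReal.ofReal C⁻¹) π a then 1 else 0) ∧
              ∀ a ∈ l, ¬ Fails V πref (ENNReal.ofReal C⁻¹) π a then 1 else 0) := by
        refine expect_mono_support _ fun l hl => ?_
        obtain ⟨hlen, hsupp⟩ := mem_support_iid hl
        have := expect_rlFineTune_le V πref herm hstar δ μ (ENNReal.ofReal (1 / 4)) l
          fun x hx => hμ x (hsupp x hx)
        rwa [hlen] at this
    _ ≤ ENNReal.ofReal (δ / 4) + ENNReal.ofReal (δ / 4) := by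
        rw [expect_add, expect_const]
        exact add_le_add (mul_one_sub_inv_pow_rollouts_le hC hδ hN1) (hP _ hunif)
    _ = _ := by
        rw [← ENNReal.ofReal_add (by positivity) (by positivity)]
        ring_nf

end BaseLearner

/-! ### The rejection sampler -/

section Sampling

variable {Tok : Type*} {X : Set (List Tok)} {T : ℕ} [NeZero T] {V : X → Tok → Bool} {k N : ℕ}
  {ens : List (Model Tok)}

theorem expect_sampleLoop_of_le {xs out : List X} (h : N ≤ out.length) (g : List X → ℝ≥0∞) :
    expect (sampleLoop T V k N ens xs out) (fun r => g r.1) = g out := by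
  cases xs <;> simp [sampleLoop, h, expect_pure]

theorem expect_sampleLoop_cons {x : X} {xs out : List X} (h : out.length < N)
    (g : List X → ℝ≥0∞) :
    expect (sampleLoop T V k N ens (x :: xs) out) (fun r => g r.1) =
      acceptProb T V k ens x *
          expect (sampleLoop T V k N ens xs (out ++ [x])) (fun r => g r.1) +
        (1 - acceptProb T V k ens x) *
          expect (sampleLoop T V k N ens xs out) (fun r => g r.1) := by
  simp only [sampleLoop, if_neg (not_le.2 h), expect_bind, expect_pure]
  exact (expect_bernoulli _ _ _).trans (by simp)

theorem coe_acceptProb_le_one (x : X) : (acceptProb T V k ens x : ℝ≥0∞) ≤ 1 := by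
  exact_mod_cast (min_le_left _ _ : acceptProb T V k ens x ≤ 1)

/-- Markov's inequality for 2^(-number accepted): each prompt contributes the factor p/2 + (1 - p) =
1 - p/2. -/
theorem expect_sampleLoop_length_lt (ρ : PMF X) {p : ℝ≥0∞}
    (hp : p = expect ρ fun x => (acceptProb T V k ens x : ℝ≥0∞)) (m : ℕ) (out : List X) :
    expect (iid ρ m) (fun D => expect (sampleLoop T V k N ens D out)
      (fun r => if r.1.length < N then 1 else 0)) ≤ 2 ^ (N - out.length) * (1 - p / 2) ^ m := by
  have hp1 : p ≤ 1 := hp ▸ expect_le_of_le ρ coe_acceptProb_le_one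
  have hstep : 2⁻¹ * p + (1 - p) = 1 - p / 2 := by
    have h2 : p / 2 ≠ ⊤ :=
      ne_top_of_le_ne_top ENNReal.one_ne_top (ENNReal.half_le_self.trans hp1)
    refine ENNReal.eq_sub_of_add_eq h2 ?_
    rw [add_right_comm, ENNReal.div_eq_inv_mul, ← ENNReal.div_eq_inv_mul, ENNReal.add_halves,
      add_tsub_cancel_of_le hp1]
  induction m generalizing out with
  | zero =>
    simp only [expect_iid_zero, sampleLoop, expect_pure, pow_zero, mul_one]
    split_ifs
    · exact one_le_pow₀ one_le_two
    · simp
  | succ m ih =>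
    rcases le_or_gt N out.length with h | h
    · simp [expect_sampleLoop_of_le h (fun l => if l.length < N then 1 else 0), not_lt.2 h,
        expect_const]
    · rw [expect_iid_succ]
      simp only [expect_sampleLoop_cons h (fun l => if l.length < N then (1 : ℝ≥0∞) else 0),
        expect_add, expect_const_mul]
      obtain ⟨e, he⟩ : ∃ e, N - out.length = e + 1 := ⟨N - out.length - 1, by omega⟩
      have he' : ∀ x : X, N - (out ++ [x]).length = e := fun x => by
        simp only [List.length_append, List.length_singleton]
        omega
      calc _ ≤ expect ρ (fun x => (acceptProb T V k ens x : ℝ≥0∞) *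
                (2 ^ e * (1 - p / 2) ^ m)) +
              expect ρ (fun x => (1 - (acceptProb T V k ens x : ℝ≥0∞)) *
                (2 ^ (e + 1) * (1 - p / 2) ^ m)) := by
            refine add_le_add (expect_mono ρ fun x => ?_) (expect_mono ρ fun x => ?_)
            · gcongr
              simpa only [he'] using ih (out ++ [x])
            · gcongr
              simpa only [he] using ih out
        _ = p * (2 ^ e * (1 - p / 2) ^ m) + (1 - p) * (2 ^ (e + 1) * (1 - p / 2) ^ m) := by
            rw [expect_mul_const, expect_mul_const, expect_one_sub ρ coe_acceptProb_le_one, ← hp]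
        _ = (2⁻¹ * p + (1 - p)) * (2 ^ (e + 1) * (1 - p / 2) ^ m) := by
            rw [add_mul, pow_succ]
            congr 1
            calc p * (2 ^ e * (1 - p / 2) ^ m) =
                (2⁻¹ * 2) * (p * (2 ^ e * (1 - p / 2) ^ m)) := by
                  rw [ENNReal.inv_mul_cancel two_ne_zero ENNReal.ofNat_ne_top, one_mul]
              _ = _ := by ring
        _ = _ := by
            rw [hstep, he, pow_succ (1 - p / 2)]
            ring

/-- The distribution `ρ` reweighted by `a`. -/
noncomputable def reweight {A : Type*} (ρ : PMF A) (a : A → ℝ≥0∞) (h0 : expect ρ a ≠ 0)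
    (h1 : expect ρ a ≠ ⊤) : PMF A :=
  PMF.normalize (fun x => ρ x * a x) h0 h1

theorem expect_mul_eq_reweight {A : Type*} (ρ : PMF A) (a : A → ℝ≥0∞) (h0 : expect ρ a ≠ 0)
    (h1 : expect ρ a ≠ ⊤) (f : A → ℝ≥0∞) :
    expect ρ (fun x => a x * f x) = expect ρ a * expect (reweight ρ a h0 h1) f := by
  have : ∀ x, reweight ρ a h0 h1 x = ρ x * a x * (expect ρ a)⁻¹ := fun x => rfl
  have hinv := ENNReal.mul_inv_cancel h0 h1
  unfold expect at this hinv ⊢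
  simp_rw [this]
  rw [← ENNReal.tsum_mul_left]
  refine tsum_congr fun x => ?_
  rw [show (∑' x, ρ x * a x) * (ρ x * a x * (∑' x, ρ x * a x)⁻¹ * f x) =
    ((∑' x, ρ x * a x) * (∑' x, ρ x * a x)⁻¹) * (ρ x * (a x * f x)) by ring,
    hinv, one_mul]

theorem support_reweight_subset {A : Type*} (ρ : PMF A) (a : A → ℝ≥0∞) (h0 : expect ρ a ≠ 0)
    (h1 : expect ρ a ≠ ⊤) : (reweight ρ a h0 h1).support ⊆ ρ.support := by
  intro x hx
  refine (ρ.mem_support_iff x).2 fun h => (PMF.mem_support_iff _ _).1 hx ?_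
  change ρ x * a x * _ = 0
  simp [h]

/-- The prompts collected by the sampler are independent samples from the reweighted
distribution. -/
theorem expect_sampleLoop_le_iid (ρ ν : PMF X) {p : ℝ≥0∞}
    (hp : p = expect ρ fun x => (acceptProb T V k ens x : ℝ≥0∞))
    (hν : ∀ f, expect ρ (fun x => (acceptProb T V k ens x : ℝ≥0∞) * f x) = p * expect ν f)
    (g : List X → ℝ≥0∞) (m : ℕ) (out : List X) (hout : out.length ≤ N) :
    expect (iid ρ m) (fun D => expect (sampleLoop T V k N ens D out)
      (fun r => if r.1.length = N then g r.1 else 0)) ≤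
        expect (iid ν (N - out.length)) fun l => g (out ++ l) := by
  have hp1 : p ≤ 1 := hp ▸ expect_le_of_le ρ coe_acceptProb_le_one
  rcases hout.eq_or_lt with h | h
  -- A full buffer stops the loop at once. Runs that exhaust the prompts before filling it count as
  -- 0, so only an inequality holds.
  · rw [h, Nat.sub_self, expect_iid_zero, List.append_nil]
    simp [expect_sampleLoop_of_le h.ge (fun l => if l.length = N then g l else 0), h,
      expect_const]
  induction m generalizing out with
  | zero => simp [expect_iid_zero, sampleLoop, expect_pure, h.ne]
  | succ m ih =>
    rw [expect_iid_succ]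
    simp only [expect_sampleLoop_cons h (fun l => if l.length = N then g l else 0),
      expect_add, expect_const_mul]
    obtain ⟨e, he⟩ : ∃ e, N - out.length = e + 1 := ⟨N - out.length - 1, by omega⟩
    have he' : ∀ x : X, N - (out ++ [x]).length = e := fun x => by
      simp only [List.length_append, List.length_singleton]
      omega
    have ih' : ∀ x : X, expect (iid ρ m) (fun D => expect (sampleLoop T V k N ens D (out ++ [x]))
        (fun r => if r.1.length = N then g r.1 else 0)) ≤
          expect (iid ν e) fun l => g (out ++ x :: l) := by
      intro x
      have hlen : (out ++ [x]).length ≤ N := by simpa using h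
      rcases hlen.eq_or_lt with h' | h'
      · have he0 : e = 0 := by rw [← he' x]; omega
        rw [he0, expect_iid_zero]
        simp [expect_sampleLoop_of_le h'.ge (fun l => if l.length = N then g l else 0),
          expect_const, -List.length_append, h']
      · simpa only [he', List.append_assoc, List.singleton_append] using
          ih (out ++ [x]) hlen h'
    -- An accepted prompt acts as the first draw from `ν`, with weight p; a rejected one leaves the
    -- target unchanged, with weight 1 - p.
    calc _ ≤ expect ρ (fun x => (acceptProb T V k ens x : ℝ≥0∞) *
              expect (iid ν e) fun l => g (out ++ x :: l)) +
            expect ρ (fun x => (1 - (acceptProb T V k ens x : ℝ≥0∞)) *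
              expect (iid ν (N - out.length)) fun l => g (out ++ l)) := by
          refine add_le_add (expect_mono ρ fun x => ?_) (expect_mono ρ fun x => ?_)
          · gcongr
            exact ih' x
          · gcongr
            exact ih out hout h
      _ = p * (expect (iid ν (N - out.length)) fun l => g (out ++ l)) +
            (1 - p) * (expect (iid ν (N - out.length)) fun l => g (out ++ l)) := by
          rw [hν, expect_mul_const, expect_one_sub ρ coe_acceptProb_le_one, ← hp, he,
            expect_iid_succ]
      _ = _ := by rw [← add_mul, add_tsub_cancel_of_le hp1, one_mul]

theorem mem_support_sampleLoop {xs out : List X} (hout : out.length ≤ N) {r : List X × ℕ}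
    (hr : r ∈ (sampleLoop T V k N ens xs out).support) :
    r.1.length ≤ N ∧ r.2 ≤ ens.length * xs.length := by
  induction xs generalizing out r with
  | nil =>
    simp only [sampleLoop, PMF.mem_support_pure_iff] at hr
    subst hr
    exact ⟨hout, by simp⟩
  | cons x xs ih =>
    rw [sampleLoop] at hr
    split_ifs at hr with h
    · simp only [PMF.mem_support_pure_iff] at hr
      subst hr
      exact ⟨hout, by simp⟩
    · simp only [PMF.mem_support_bind_iff, PMF.mem_support_pure_iff] at hr
      obtain ⟨b, -, r', hr', rfl⟩ := hr
      have hlen : (if b = true then out ++ [x] else out).length ≤ N := by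
        split_ifs
        · simp
          omega
        · exact hout
      obtain ⟨h1, h2⟩ := ih hlen hr'
      refine ⟨h1, ?_⟩
      simp only [List.length_cons]
      linarith

end Sampling

/-! ### The potential of boosting by filtering -/

section Weights

theorem betaAux_nonneg (k i r : ℕ) : 0 ≤ betaAux k i r := by
  induction i generalizing r with
  | zero =>
    rw [betaAux]
    split_ifs <;> norm_num
  | succ i ih =>
    have h1 := ih r
    have h2 := ih (r + 1)
    simp only [betaAux, errStar]
    linarith

theorem betaAux_le_one (k i r : ℕ) : betaAux k i r ≤ 1 := by
  induction i generalizing r with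
  | zero =>
    rw [betaAux]
    split_ifs <;> norm_num
  | succ i ih =>
    have h1 := ih r
    have h2 := ih (r + 1)
    simp only [betaAux, errStar]
    linarith

theorem betaAux_succ_le (k i r : ℕ) : betaAux k i (r + 1) ≤ betaAux k i r := by
  induction i generalizing r with
  | zero =>
    simp only [betaAux]
    split_ifs with h1 h2
    · rfl
    · push_cast at h1
      linarith
    · norm_num
    · rfl
  | succ i ih =>
    have h1 := ih r
    have h2 := ih (r + 1)
    simp only [betaAux, errStar]
    linarith

/-- Chernoff's method: the final indicator is at most 3^(k/2 - r), and every backward step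
multiplies this by 1/4 + (3/4)(1/3) = 1/2. -/
theorem betaAux_le_pow (k i r : ℕ) :
    betaAux k i r ≤ (1 / 2) ^ i * (√3 ^ k * (1 / 3) ^ r) := by
  induction i generalizing r with
  | zero =>
    rw [betaAux]
    split_ifs with h
    · have h1 : r + r ≤ k := by
        have : ((r + r : ℕ) : ℝ) ≤ k := by
          push_cast
          linarith
        exact_mod_cast this
      have h3 : (1 : ℝ) ≤ √3 := Real.one_le_sqrt.2 (by norm_num)
      have h4 : (1 : ℝ) ≤ √3 ^ (k - (r + r)) := one_le_pow₀ h3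
      have h5 : √3 ^ k = √3 ^ (k - (r + r)) * 3 ^ r := by
        rw [← Nat.sub_add_cancel h1, Nat.add_sub_cancel, pow_add, ← two_mul, pow_mul,
          Real.sq_sqrt (by norm_num)]
      rw [h5, mul_assoc, ← mul_pow]
      norm_num
      exact h4
    · positivity
  | succ i ih =>
    have h1 := ih r
    have h2 := ih (r + 1)
    simp only [betaAux, errStar]
    calc _ ≤ 1 / 4 * ((1 / 2) ^ i * (√3 ^ k * (1 / 3) ^ r)) +
          (1 - 1 / 4) * ((1 / 2) ^ i * (√3 ^ k * (1 / 3) ^ (r + 1))) := by linarith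
      _ = _ := by ring

theorem beta_zero_sq_le (k : ℕ) : beta 0 k 0 ^ 2 ≤ (3 / 4) ^ k := by
  have h : beta 0 k 0 ≤ (√3 / 2) ^ k := by
    refine (betaAux_le_pow k (k - 0) 0).trans_eq ?_
    rw [Nat.sub_zero, pow_zero, mul_one, ← mul_pow]
    ring
  calc beta 0 k 0 ^ 2 ≤ ((√3 / 2) ^ k) ^ 2 := pow_le_pow_left₀ (betaAux_nonneg _ _ _) h 2
    _ = ((√3) ^ 2 / 4) ^ k := by rw [← pow_mul, mul_comm, pow_mul]; ring
    _ = _ := by rw [Real.sq_sqrt (by norm_num)]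

theorem alpha_nonneg (j k r : ℕ) : 0 ≤ alpha j k r := sub_nonneg.2 (betaAux_succ_le _ _ _)

theorem alpha_le_one (j k r : ℕ) : alpha j k r ≤ 1 := by
  have h1 := betaAux_le_one k (k - (j + 1)) r
  have h2 := betaAux_nonneg k (k - (j + 1)) (r + 1)
  simp only [alpha, beta]
  linarith

theorem alpha_le_alphaMax {j k r : ℕ} (h : r ≤ j) : alpha j k r ≤ alphaMax j k :=
  Finset.le_sup' (alpha j k) (Finset.mem_range.2 (Nat.lt_succ_of_le h))

theorem alphaMax_nonneg (j k : ℕ) : 0 ≤ alphaMax j k :=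
  (alpha_nonneg j k 0).trans (alpha_le_alphaMax (Nat.zero_le j))

theorem alphaMax_le_one (j k : ℕ) : alphaMax j k ≤ 1 :=
  Finset.sup'_le _ _ fun _ _ => alpha_le_one _ _ _

theorem beta_nonneg (j k r : ℕ) : 0 ≤ beta j k r := betaAux_nonneg _ _ _

theorem beta_eq {j k : ℕ} (h : j < k) (r : ℕ) :
    beta j k r = beta (j + 1) k (r + 1) + 1 / 4 * alpha j k r := by
  have : k - j = (k - (j + 1)) + 1 := by omega
  simp only [alpha, beta, this, betaAux, errStar]
  ring

end Weights

/-! ### The change of the potential when a model is appended. -/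

section Potential

variable {Tok : Type*} {X : Set (List Tok)} {T : ℕ} [NeZero T] {V : X → Tok → Bool} {k : ℕ}

theorem rank_le_length (ens : List (Model Tok)) (x : X) : rank T V ens x ≤ ens.length :=
  List.countP_le_length

/-- The product form also covers `alphaMax` = 0: the ratio is then 0 by convention, and the weights
vanish as well. -/
theorem acceptProb_mul_alphaMax (ens : List (Model Tok)) (x : X) :
    (acceptProb T V k ens x : ℝ≥0∞) * ENNReal.ofReal (alphaMax ens.length k) =
      ENNReal.ofReal (alpha ens.length k (rank T V ens x)) := by
  have h1 := alpha_le_alphaMax (k := k) (rank_le_length (V := V) (T := T) ens x)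
  have h2 := alpha_nonneg ens.length k (rank T V ens x)
  have h3 := alphaMax_nonneg ens.length k
  have h4 : alpha ens.length k (rank T V ens x) / alphaMax ens.length k ≤ 1 :=
    div_le_one_of_le₀ h1 h3
  have h5 : acceptProb T V k ens x =
      Real.toNNReal (alpha ens.length k (rank T V ens x) / alphaMax ens.length k) :=
    min_eq_right (by simpa using h4)
  rw [h5]
  change ENNReal.ofReal _ * _ = _
  rw [← ENNReal.ofReal_mul (div_nonneg h2 h3)]
  rcases h3.eq_or_lt with h | h
  · rw [← h] at h1 ⊢
    simp [le_antisymm h1 h2]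
  · rw [div_mul_cancel₀ _ h.ne']

/-- The potential of an ensemble. -/
noncomputable def potential (T : ℕ) [NeZero T] (ρ : PMF X) (V : X → Tok → Bool) (k : ℕ)
    (ens : List (Model Tok)) : ℝ≥0∞ :=
  expect ρ fun x => ENNReal.ofReal (beta ens.length k (rank T V ens x))

/-- The part of the potential that does not depend on the next model. -/
noncomputable def basePotential (T : ℕ) [NeZero T] (ρ : PMF X) (V : X → Tok → Bool) (k : ℕ)
    (ens : List (Model Tok)) : ℝ≥0∞ :=
  expect ρ fun x => ENNReal.ofReal (beta (ens.length + 1) k (rank T V ens x + 1))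

theorem potential_eq (ρ : PMF X) {ens : List (Model Tok)} (h : ens.length < k) :
    potential T ρ V k ens = basePotential T ρ V k ens + ENNReal.ofReal (1 / 4) *
      (ENNReal.ofReal (alphaMax ens.length k) *
        expect ρ fun x => (acceptProb T V k ens x : ℝ≥0∞)) := by
  rw [potential, basePotential, ← expect_const_mul, ← expect_const_mul, ← expect_add]
  congr 1
  funext x
  rw [mul_comm (ENNReal.ofReal (alphaMax _ _)), acceptProb_mul_alphaMax,
    ← ENNReal.ofReal_mul (by norm_num),
    ← ENNReal.ofReal_add (beta_nonneg _ _ _) (mul_nonneg (by norm_num) (alpha_nonneg _ _ _)),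
    ← beta_eq h]

/-- A correct answer raises the rank by one; an error leaves it, and the difference of the two β
values is α. In `potential_eq` the error indicator is replaced by 1/4. -/
theorem potential_append (ρ : PMF X) (ens : List (Model Tok)) (π : Model Tok) :
    potential T ρ V k (ens ++ [π]) = basePotential T ρ V k ens +
      ENNReal.ofReal (alphaMax ens.length k) *
        expect ρ fun x => (acceptProb T V k ens x : ℝ≥0∞) * errInd T V π x := by
  rw [potential, basePotential, ← expect_const_mul, ← expect_add]
  congr 1
  funext x
  rw [← mul_assoc, mul_comm (ENNReal.ofReal (alphaMax _ _)), acceptProb_mul_alphaMax]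
  by_cases h : V x (modelAnswer π T x) = true
  · simp [errInd, h, rank, List.countP_append]
  · rw [errInd, if_neg h, mul_one, ← ENNReal.ofReal_add (beta_nonneg _ _ _)
      (alpha_nonneg _ _ _)]
    simp [h, rank, List.countP_append, alpha]

theorem errInd_le_one (π : Model Tok) (x : X) : errInd T V π x ≤ 1 := by
  unfold errInd
  split_ifs <;> simp

theorem potential_append_le_of_accept (ρ : PMF X) {ens : List (Model Tok)} (h : ens.length < k)
    (π : Model Tok) {τ : ℝ≥0∞}
    (hτ : expect ρ (fun x => (acceptProb T V k ens x : ℝ≥0∞)) ≤ τ) :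
    potential T ρ V k (ens ++ [π]) ≤ potential T ρ V k ens + τ := by
  rw [potential_append, potential_eq ρ h]
  refine add_le_add le_self_add ?_
  refine le_trans (mul_le_of_le_one_left' ?_) ((expect_mono ρ fun x => ?_).trans hτ)
  · exact ENNReal.ofReal_le_one.2 (alphaMax_le_one _ _)
  · exact mul_le_of_le_one_right' (errInd_le_one π x)

theorem potential_append_le_of_err (ρ ν : PMF X) {ens : List (Model Tok)} (h : ens.length < k)
    (π : Model Tok)
    (hν : ∀ f, expect ρ (fun x => (acceptProb T V k ens x : ℝ≥0∞) * f x) =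
      expect ρ (fun x => (acceptProb T V k ens x : ℝ≥0∞)) * expect ν f)
    (herr : expect ν (errInd T V π) ≤ ENNReal.ofReal (1 / 4)) :
    potential T ρ V k (ens ++ [π]) ≤ potential T ρ V k ens := by
  rw [potential_append, potential_eq ρ h, hν]
  refine add_le_add_right ?_ _
  calc _ ≤ ENNReal.ofReal (alphaMax ens.length k) *
        (expect ρ (fun x => (acceptProb T V k ens x : ℝ≥0∞)) * ENNReal.ofReal (1 / 4)) := by
        gcongr
    _ = _ := by ring

end Potential

/-! ### One phase of the algorithm -/

section Phase

variable {Tok : Type*} {X : Set (List Tok)} {T : ℕ} [NeZero T]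

open scoped Classical in
theorem expect_phase_le [Fintype Tok] [DecidableEq Tok] (ρ : PMF X) (V : X → Tok → Bool)
    (πref : X → PMF (Response Tok T)) {C : ℝ} (hC : 1 ≤ C)
    {Pi : Set (Model Tok)} {d : ℕ} (hd : natarajanDim Pi = d)
    {erm : List (X × Set (Response Tok T)) → Model Tok}
    (herm : IsERM Pi erm) {πstar : Model Tok} (hstar : πstar ∈ Pi) {δ : ℝ} (hδ : 0 < δ)
    (hρ : ∀ x ∈ ρ.support, ENNReal.ofReal C⁻¹ ≤ πref x (cot πstar T x) ∧
      V x (modelAnswer πstar T x) = true) {N : ℕ} (hN1 : 1 ≤ N)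
    (hN : d * Real.log (20 * (Fintype.card Tok) ^ 2 * C * T) + Real.log (4 / δ) ≤ N / 10)
    {k m : ℕ} {ens : List (Model Tok)} (hens : ens.length < k) {τ : ℝ≥0∞}
    (hm : 2 ^ N * (1 - τ / 2) ^ m ≤ ENNReal.ofReal (δ / 2)) :
    expect (iid ρ m) (fun D => expect (sampleLoop T V k N ens D []) fun s =>
      expect (rlFineTune V πref C erm δ s.1) fun b =>
        if potential T ρ V k (ens ++ [b.1]) ≤ potential T ρ V k ens + τ then 0 else 1) ≤
      ENNReal.ofReal δ := by
  set p := expect ρ (fun x => (acceptProb T V k ens x : ℝ≥0∞)) with hp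
  -- For rare acceptance the sampler may return too few prompts, but then the returned model is
  -- harmless whatever it is.
  rcases le_or_gt p τ with hτ | hτ
  · have : ∀ π, potential T ρ V k (ens ++ [π]) ≤ potential T ρ V k ens + τ := fun π =>
      potential_append_le_of_accept ρ hens π hτ
    simp [this, expect_const]
  have hp0 : p ≠ 0 := (zero_le.trans_lt hτ).ne'
  have hp1 : p ≤ 1 := expect_le_of_le ρ coe_acceptProb_le_one
  have hpt : p ≠ ⊤ := ne_top_of_le_ne_top ENNReal.one_ne_top hp1
  set ν := reweight ρ _ hp0 hpt
  have hν := expect_mul_eq_reweight ρ _ hp0 hpt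
  set g : List X → ℝ≥0∞ := fun l => expect (rlFineTune V πref C erm δ l)
    (fun b => if ENNReal.ofReal (1 / 4) ≤ expect ν (errInd T V b.1) then 1 else 0) with hg
  calc _ ≤ expect (iid ρ m) (fun D => expect (sampleLoop T V k N ens D []) fun s =>
          (if s.1.length < N then 1 else 0) + if s.1.length = N then g s.1 else 0) := by
        refine expect_mono _ fun D => expect_mono_support _ fun s hs => ?_
        have hlen := (mem_support_sampleLoop (Nat.zero_le N) hs).1
        rcases hlen.eq_or_lt with h | h
        · rw [if_neg h.not_lt, if_pos h, zero_add, hg]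
          refine expect_mono _ fun b => ?_
          by_cases hb : ENNReal.ofReal (1 / 4) ≤ expect ν (errInd T V b.1)
          · rw [if_pos hb]
            split_ifs <;> simp
          · rw [if_pos ((potential_append_le_of_err ρ ν hens b.1 hν
              (not_le.1 hb).le).trans le_self_add)]
            simp
        · rw [if_pos h, if_neg h.ne, add_zero]
          refine expect_le_of_le _ fun b => ?_
          split_ifs <;> simp
    _ ≤ ENNReal.ofReal (δ / 2) + ENNReal.ofReal (δ / 2) := by
        simp only [expect_add]
        refine add_le_add ?_ ?_
        · refine (expect_sampleLoop_length_lt ρ hp m []).trans (le_trans ?_ hm)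
          rw [List.length_nil, Nat.sub_zero]
          gcongr
        · refine (expect_sampleLoop_le_iid ρ ν hp hν g m [] (Nat.zero_le N)).trans ?_
          simp only [List.length_nil, Nat.sub_zero, List.nil_append]
          exact expect_iid_rlFineTune_le V πref hC hd herm hstar hδ ν
            (fun x hx => hρ x (support_reweight_subset ρ _ hp0 hpt hx)) hN1 hN
    _ = _ := by
        rw [← ENNReal.ofReal_add (by positivity) (by positivity)]
        ring_nf

end Phase

/-! ### All phases of the algorithm -/

/-! ### Disjoint blocks of an i.i.d. sample are independent. -/

section Split

variable {A : Type*}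

theorem expect_iid_chunks (p : PMF A) (k m n : ℕ) (h : k * m ≤ n) (φ : List (List A) → ℝ≥0∞) :
    expect (iid p n) (fun D => φ ((List.range k).map fun j => (D.drop (j * m)).take m)) =
      expect (iid (iid p m) k) φ := by
  induction k generalizing n φ with
  | zero => simp [expect_iid_zero, expect_const]
  | succ k ih =>
    obtain ⟨n', rfl⟩ : ∃ n', n = m + n' := ⟨n - m, by rw [Nat.succ_mul] at h; omega⟩
    rw [expect_iid_add, expect_iid_succ]
    refine expect_congr_support _ fun l hl => ?_
    have hlen := (mem_support_iid hl).1
    rw [← ih n' (by rw [Nat.succ_mul] at h; omega) fun parts => φ (l :: parts)]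
    congr 1
    funext l'
    rw [List.range_succ_eq_map, List.map_cons, List.map_map]
    congr 2
    · simp [← hlen]
    · refine List.map_congr_left fun j _ => ?_
      have : (j + 1) * m = l.length + j * m := by rw [hlen]; ring
      simp [this, ← List.drop_drop]

theorem expect_iid_split (p : PMF A) (k n : ℕ) (φ : List (List A) → ℝ≥0∞) :
    expect (iid p n) (fun D => φ (split k D)) = expect (iid (iid p (n / k)) k) φ := by
  rw [← expect_iid_chunks p k (n / k) n (Nat.mul_div_le n k)]
  refine expect_congr_support _ fun D hD => ?_
  rw [split, (mem_support_iid hD).1]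

theorem length_le_of_mem_split {k : ℕ} {D l : List A} (h : l ∈ split k D) :
    l.length ≤ D.length / k := by
  obtain ⟨j, -, rfl⟩ := List.mem_map.1 h
  exact List.length_take_le _ _

theorem length_split (k : ℕ) (D : List A) : (split k D).length = k := by simp [split]

end Split

section Phases

variable {Tok : Type*} {X : Set (List Tok)} {T : ℕ} [NeZero T]

theorem length_of_mem_support_phases {V : X → Tok → Bool} {πref : X → PMF (Response Tok T)}
    {C δ : ℝ} {erm : List (X × Set (Response Tok T)) → Model Tok} {k N : ℕ}
    {parts : List (List X)} {ens : List (Model Tok)} {r : List (Model Tok) × Cost}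
    (hr : r ∈ (phases V πref C erm k N δ parts ens).support) :
    r.1.length = ens.length + parts.length := by
  induction parts generalizing ens r with
  | nil =>
    simp only [phases, PMF.mem_support_pure_iff] at hr
    simp [hr]
  | cons D parts ih =>
    simp only [phases, PMF.mem_support_bind_iff, PMF.mem_support_pure_iff] at hr
    obtain ⟨s, -, b, -, r', hr', rfl⟩ := hr
    simp only [ih hr', List.length_append, List.length_cons, List.length_nil]
    ring

open scoped Classical in
theorem expect_phases_le [Fintype Tok] [DecidableEq Tok] (ρ : PMF X) (V : X → Tok → Bool)
    (πref : X → PMF (Response Tok T)) {C : ℝ} (hC : 1 ≤ C)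
    {Pi : Set (Model Tok)} {d : ℕ} (hd : natarajanDim Pi = d)
    {erm : List (X × Set (Response Tok T)) → Model Tok}
    (herm : IsERM Pi erm) {πstar : Model Tok} (hstar : πstar ∈ Pi)
    {k : ℕ} {δ : ℝ} (hδ : 0 < δ / k)
    (hρ : ∀ x ∈ ρ.support, ENNReal.ofReal C⁻¹ ≤ πref x (cot πstar T x) ∧
      V x (modelAnswer πstar T x) = true) {N : ℕ} (hN1 : 1 ≤ N)
    (hN : d * Real.log (20 * (Fintype.card Tok) ^ 2 * C * T) + Real.log (4 / (δ / k)) ≤ N / 10)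
    {m : ℕ} {τ : ℝ≥0∞} (hm : 2 ^ N * (1 - τ / 2) ^ m ≤ ENNReal.ofReal (δ / k / 2))
    (i : ℕ) (ens : List (Model Tok)) (hens : ens.length + i = k) :
    expect (iid (iid ρ m) i) (fun parts => expect (phases V πref C erm k N δ parts ens) fun r =>
      if potential T ρ V k r.1 ≤ potential T ρ V k ens + i * τ then 0 else 1) ≤
        i * ENNReal.ofReal (δ / k) := by
  induction i generalizing ens with
  | zero => simp [expect_iid_zero, phases, expect_pure]
  | succ i ih =>
    rw [expect_iid_succ]
    simp only [phases, expect_bind, expect_pure]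
    -- The later parts are independent of this phase; moving their expectation inside lets the
    -- induction hypothesis apply to the new ensemble.
    calc _ = expect (iid ρ m) (fun D => expect (sampleLoop T V k N ens D []) fun s =>
          expect (rlFineTune V πref C erm (δ / k) s.1) fun b =>
          expect (iid (iid ρ m) i) fun parts =>
          expect (phases V πref C erm k N δ parts (ens ++ [b.1])) fun r =>
            if potential T ρ V k r.1 ≤ potential T ρ V k ens + (i + 1 : ℕ) * τ then 0 else 1) := by
          congr 1
          funext D
          rw [expect_comm]
          congr 1
          funext s
          rw [expect_comm]
      _ ≤ expect (iid ρ m) (fun D => expect (sampleLoop T V k N ens D []) fun s =>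
          expect (rlFineTune V πref C erm (δ / k) s.1) fun b =>
          (if potential T ρ V k (ens ++ [b.1]) ≤ potential T ρ V k ens + τ then 0 else 1) +
            i * ENNReal.ofReal (δ / k)) := by
          refine expect_mono _ fun D => expect_mono _ fun s => expect_mono _ fun b => ?_
          by_cases hb : potential T ρ V k (ens ++ [b.1]) ≤ potential T ρ V k ens + τ
          · rw [if_pos hb, zero_add]
            refine le_trans (expect_mono _ fun parts => expect_mono _ fun r => ?_)
              (ih (ens ++ [b.1]) (by simp; omega))
            by_cases h : potential T ρ V k r.1 ≤ potential T ρ V k (ens ++ [b.1]) + i * τ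
            · rw [if_pos h, if_pos]
              refine h.trans ((add_le_add_left hb _).trans_eq ?_)
              push_cast
              ring
            · rw [if_neg h]
              split_ifs <;> simp
          · rw [if_neg hb]
            refine le_trans (expect_le_of_le _ fun parts => expect_le_of_le _ fun r => ?_)
              le_self_add
            split_ifs <;> simp
      _ ≤ ENNReal.ofReal (δ / k) + i * ENNReal.ofReal (δ / k) := by
          simp only [expect_add, expect_const]
          refine add_le_add_left ?_ _
          exact expect_phase_le ρ V πref hC hd herm hstar hδ hρ hN1 hN (by omega) hm
      _ = _ := by
          push_cast
          ring

end Phases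

/-! ### The plurality vote -/

section Vote

variable {Tok : Type*} {X : Set (List Tok)} {T : ℕ}

theorem IsPlurality.eq_of_count [DecidableEq Tok] {plu : List Tok → Tok} (h : IsPlurality plu)
    {l : List Tok} {y : Tok} (hy : l.length < 2 * l.count y) : plu l = y := by
  by_contra hne
  have hl : l ≠ [] := by
    rintro rfl
    simp at hy
  have h1 := h l hl y
  have h2 : l.count (plu l) + l.count y ≤ l.length := by
    have h3 := List.length_eq_countP_add_countP (l := l) (fun z => z == y)
    have h4 : l.count (plu l) ≤ l.countP (fun z => ¬(z == y) = true) :=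
      List.countP_mono_left fun z _ hz => by
        have : z = plu l := by simpa using hz
        simp [this, hne]
    have h5 : l.count y = l.countP (fun z => z == y) := rfl
    omega
  omega

theorem accuracy_add_error (ρ : PMF X) (V : X → Tok → Bool) (f : X → Tok) :
    accuracy ρ V f + expect ρ (fun x => if V x (f x) = true then (0 : ℝ≥0∞) else 1) = 1 := by
  refine Eq.trans ?_ (expect_const ρ 1)
  change expect ρ _ + _ = _
  rw [← expect_add]
  congr 1
  funext x
  split_ifs <;> simp

theorem accuracy_eq_one {ρ : PMF X} {V : X → Tok → Bool} {f : X → Tok}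
    (h : accuracy ρ V f = 1) : ∀ x ∈ ρ.support, V x (f x) = true := by
  intro x hx
  by_contra hne
  have h1 : expect ρ (fun x => if V x (f x) = true then (0 : ℝ≥0∞) else 1) = 0 := by
    have h2 := accuracy_add_error ρ V f
    rw [h] at h2
    exact (ENNReal.add_right_inj ENNReal.one_ne_top).1 (h2.trans (add_zero 1).symm)
  have h3 := ENNReal.tsum_eq_zero.1 h1 x
  simp [hne] at h3
  exact (ρ.mem_support_iff x).1 hx h3

variable [NeZero T]

/-- All correct models give the same answer, so the rank is its vote count; the vote can err only at
rank at most k/2, where β^{k,k} = 1. -/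
theorem errInd_vote_le [DecidableEq Tok] {V : X → Tok → Bool} (hV : SparseVerifier V)
    {plu : List Tok → Tok} (h : IsPlurality plu) (ens : List (Model Tok)) (x : X) :
    (if V x (plu (ens.map fun π => modelAnswer π T x)) = true then (0 : ℝ≥0∞) else 1) ≤
      ENNReal.ofReal (beta ens.length ens.length (rank T V ens x)) := by
  split_ifs with hx
  · exact zero_le
  · obtain ⟨y, hy, hy'⟩ := hV x
    have hrank : rank T V ens x = (ens.map fun π => modelAnswer π T x).count y := by
      rw [rank, List.count, List.countP_map]
      refine List.countP_congr fun π _ => ?_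
      simp only [Function.comp, beq_iff_eq]
      exact ⟨fun h => hy' _ h, fun h => h ▸ hy⟩
    have hle : 2 * rank T V ens x ≤ ens.length := by
      by_contra hlt
      refine hx ?_
      rwa [h.eq_of_count (y := y)]
      rw [← hrank, List.length_map]
      omega
    have hle' : (2 : ℝ) * rank T V ens x ≤ ens.length := by exact_mod_cast hle
    rw [beta, Nat.sub_self, betaAux, if_pos (by linarith), ENNReal.ofReal_one]

theorem le_accuracy_vote [DecidableEq Tok] {ρ : PMF X} {V : X → Tok → Bool}
    (hV : SparseVerifier V) {plu : List Tok → Tok} (h : IsPlurality plu) {ens : List (Model Tok)}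
    {k : ℕ} (hk : ens.length = k) {ε : ℝ} (hε : 0 ≤ ε)
    (hpot : potential T ρ V k ens ≤ ENNReal.ofReal ε) :
    ENNReal.ofReal (1 - ε) ≤
      accuracy ρ V (fun x => plu (ens.map fun π => modelAnswer π T x)) := by
  subst hk
  rw [ENNReal.ofReal_sub _ hε, ENNReal.ofReal_one, tsub_le_iff_right]
  calc (1 : ℝ≥0∞) = accuracy ρ V (fun x => plu (ens.map fun π => modelAnswer π T x)) +
        expect ρ (fun x =>
          if V x (plu (ens.map fun π => modelAnswer π T x)) = true then (0 : ℝ≥0∞) else 1) :=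
        (accuracy_add_error ρ V _).symm
    _ ≤ _ := add_le_add_right ((expect_mono ρ fun x => errInd_vote_le hV h ens x).trans hpot) _

/-- The accuracy guarantee of `AutoTune`, for every choice of the parameters that satisfies the
inequalities of the analysis. -/
theorem expect_autoTuneRun_le [Fintype Tok] [DecidableEq Tok] (ρ : PMF X) {V : X → Tok → Bool}
    (hV : SparseVerifier V) (πref : X → PMF (Response Tok T)) {C : ℝ} (hC : 1 ≤ C)
    {Pi : Set (Model Tok)} {d : ℕ} (hd : natarajanDim Pi = d)
    {erm : List (X × Set (Response Tok T)) → Model Tok}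
    (herm : IsERM Pi erm) {plu : List Tok → Tok} (hplu : IsPlurality plu)
    {πstar : Model Tok} (hstar : πstar ∈ Pi)
    (hacc : accuracy ρ V (fun x => modelAnswer πstar T x) = 1)
    (hcov : SequenceCoverage ρ πref πstar C)
    {ck cn ε δ : ℝ} {s k N n : ℕ} (hk : numPhases ck ε = k)
    (hNe : rlSampleComplexity cn d s T C errStar (δ / k) = N)
    (hk0 : 0 < k) (hδ : 0 < δ) (hε : 0 ≤ ε) (hN1 : 1 ≤ N)
    (hN : d * Real.log (20 * (Fintype.card Tok) ^ 2 * C * T) + Real.log (4 / (δ / k)) ≤ N / 10)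
    {τ : ℝ≥0∞} (hm : 2 ^ N * (1 - τ / 2) ^ (n / k) ≤ ENNReal.ofReal (δ / k / 2))
    (hτ : ENNReal.ofReal (beta 0 k 0) + k * τ ≤ ENNReal.ofReal ε) :
    ENNReal.ofReal (1 - δ) ≤
      (autoTuneRun ρ V πref C erm plu ck cn d s ε δ n).toOuterMeasure
        {r | ENNReal.ofReal (1 - ε) ≤ accuracy ρ V r.1} := by
  classical
  rw [ENNReal.ofReal_sub _ hδ.le, ENNReal.ofReal_one]
  apply one_sub_le_toOuterMeasure
  have hk0' : (0 : ℝ) < k := by exact_mod_cast hk0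
  simp only [autoTuneRun, autoTuneRL, hk, hNe, expect_bind, expect_pure]
  have hρ : ∀ x ∈ ρ.support, ENNReal.ofReal C⁻¹ ≤ πref x (cot πstar T x) ∧
      V x (modelAnswer πstar T x) = true := fun x hx => ⟨hcov x hx, accuracy_eq_one hacc x hx⟩
  have hpot : potential T ρ V k [] = ENNReal.ofReal (beta 0 k 0) := by
    simp [potential, rank, expect_const]
  rw [expect_iid_split ρ k n fun parts => expect (phases V πref C erm k N δ parts []) _]
  calc _ ≤ expect (iid (iid ρ (n / k)) k) (fun parts =>
          expect (phases V πref C erm k N δ parts []) fun r =>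
            if potential T ρ V k r.1 ≤ potential T ρ V k [] + k * τ then 0 else 1) := by
        refine expect_mono_support _ fun parts hparts => expect_mono_support _ fun r hr => ?_
        by_cases h : potential T ρ V k r.1 ≤ potential T ρ V k [] + k * τ
        · rw [if_pos h, Set.indicator_of_notMem]
          rw [Set.notMem_compl_iff, Set.mem_ofPred_eq]
          refine le_accuracy_vote hV hplu ?_ hε (h.trans (by rwa [hpot]))
          rw [length_of_mem_support_phases hr, (mem_support_iid hparts).1, List.length_nil,
            zero_add]
        · rw [if_neg h]
          exact Set.indicator_le_self' (by simp) _
    _ ≤ k * ENNReal.ofReal (δ / k) :=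
        expect_phases_le ρ V πref hC hd herm hstar (by positivity) hρ hN1 hN hm k [] (by simp)
    _ = ENNReal.ofReal δ := by
        rw [← ENNReal.ofReal_natCast, ← ENNReal.ofReal_mul hk0'.le, mul_div_cancel₀ _ hk0'.ne']

end Vote

/-! ### Computational cost -/

section CostBounds

variable {Tok : Type*} {X : Set (List Tok)} {T : ℕ} [NeZero T]

theorem mul_rolloutsPerPrompt_mono {C δ : ℝ} (hC : 0 < C) (hδ : 0 < δ) {l N : ℕ} (h : l ≤ N) :
    l * rolloutsPerPrompt C δ l ≤ N * rolloutsPerPrompt C δ N := by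
  -- The product vanishes at l = 0; for l > 0 the logarithm is monotone.
  rcases l.eq_zero_or_pos with rfl | hl
  · simp
  · refine Nat.mul_le_mul h (Nat.ceil_mono ?_)
    have : (0 : ℝ) < l := by exact_mod_cast hl
    gcongr

theorem cost_of_mem_support_phases {V : X → Tok → Bool} {πref : X → PMF (Response Tok T)}
    {C δ : ℝ} (hC : 0 < C) {erm : List (X × Set (Response Tok T)) → Model Tok} {k N m : ℕ}
    (hδ : 0 < δ / k) {parts : List (List X)} (hparts : ∀ D ∈ parts, D.length ≤ m)
    {ens : List (Model Tok)} (hens : ens.length + parts.length ≤ k)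
    {r : List (Model Tok) × Cost}
    (hr : r ∈ (phases V πref C erm k N δ parts ens).support) :
    r.2.ref ≤ parts.length * (N * rolloutsPerPrompt C (δ / k) N) ∧
      r.2.model ≤ parts.length * (k * m) := by
  induction parts generalizing ens r with
  | nil =>
    simp only [phases, PMF.mem_support_pure_iff] at hr
    simp [hr]
  | cons D parts ih =>
    simp only [phases, PMF.mem_support_bind_iff, PMF.mem_support_pure_iff] at hr
    obtain ⟨s, hs, b, hb, r', hr', rfl⟩ := hr
    simp only [List.forall_mem_cons] at hparts
    simp only [List.length_cons] at hens
    obtain ⟨h1, h2⟩ := ih hparts.2 (by simp; omega) hr'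
    obtain ⟨h3, h4⟩ := mem_support_sampleLoop (Nat.zero_le N) hs
    simp only [rlFineTune, PMF.mem_support_bind_iff, PMF.mem_support_pure_iff] at hb
    obtain ⟨S, -, rfl⟩ := hb
    have h5 := mul_rolloutsPerPrompt_mono hC hδ h3
    have h6 : ens.length * D.length ≤ k * m := Nat.mul_le_mul (by omega) hparts.1
    simp only [List.length_cons, Nat.succ_mul]
    exact ⟨by omega, by omega⟩

theorem cost_of_mem_support_autoTuneRun {ρ : PMF X} {V : X → Tok → Bool}
    {πref : X → PMF (Response Tok T)} {C : ℝ} (hC : 0 < C)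
    {erm : List (X × Set (Response Tok T)) → Model Tok} {plu : List Tok → Tok}
    {ck cn ε δ : ℝ} {d s k N n : ℕ} (hk : numPhases ck ε = k)
    (hNe : rlSampleComplexity cn d s T C errStar (δ / k) = N) (hδ : 0 < δ / k)
    {r : (X → Tok) × Cost} (hr : r ∈ (autoTuneRun ρ V πref C erm plu ck cn d s ε δ n).support) :
    r.2.ref ≤ k * (N * rolloutsPerPrompt C (δ / k) N) ∧ r.2.model ≤ k * n := by
  simp only [autoTuneRun, autoTuneRL, hk, hNe, PMF.mem_support_bind_iff,
    PMF.mem_support_pure_iff] at hr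
  obtain ⟨D, hD, r', hr', rfl⟩ := hr
  have hlen := (mem_support_iid hD).1
  obtain ⟨h1, h2⟩ := cost_of_mem_support_phases hC hδ (m := n / k)
    (fun l hl => hlen ▸ length_le_of_mem_split hl) (by simp [length_split]) hr'
  rw [length_split] at h1 h2
  exact ⟨h1, h2.trans (Nat.mul_le_mul_left k (Nat.mul_div_le n k))⟩

end CostBounds

/-! ### Choice of the parameters -/

section Parameters

theorem one_le_numPhases {ε : ℝ} (h0 : 0 < ε) (h1 : ε < 1) : 1 ≤ numPhases 1 ε := by
  have := Real.log_pos (one_lt_one_div h0 h1)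
  refine Nat.one_le_iff_ne_zero.2 (Nat.pos_iff_ne_zero.1 (Nat.ceil_pos.2 ?_))
  unfold errStar
  positivity

theorem le_numPhases (ε : ℝ) : 16 * Real.log ε⁻¹ ≤ numPhases 1 ε := by
  refine le_trans (le_of_eq ?_) (Nat.le_ceil _)
  rw [errStar, one_div ε]
  ring

theorem numPhases_le {ε : ℝ} (h0 : 0 < ε) (h1 : ε < 1) :
    (numPhases 1 ε : ℝ) ≤ 16 * (1 + Real.log ε⁻¹) := by
  have h := Real.log_pos (one_lt_one_div h0 h1)
  have h2 := (Nat.ceil_lt_add_one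
    (show 0 ≤ 1 * Real.log (1 / ε) / errStar ^ 2 by unfold errStar; positivity)).le
  rw [numPhases]
  refine h2.trans ?_
  rw [errStar, one_div ε, show 1 * Real.log ε⁻¹ / (1 / 4) ^ 2 = 16 * Real.log ε⁻¹ by ring]
  linarith

/-- (3/4)^k ≤ e^{-k/4} ≤ ε⁴ suffices for ε ≤ 15/16; for larger ε one phase does, as 3/4 ≤ (15/16)⁴.
The missing ε/16 is reserved for the k increases τ. -/
theorem beta_zero_le {ε : ℝ} (h0 : 0 < ε) {k : ℕ} (hk1 : 1 ≤ k) (hk : 16 * Real.log ε⁻¹ ≤ k) :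
    beta 0 k 0 ≤ 15 / 16 * ε := by
  refine le_of_sq_le_sq (beta_zero_sq_le k |>.trans ?_) (by positivity)
  rcases le_or_gt ε (15 / 16) with h | h
  · have h1 : (3 / 4 : ℝ) ≤ Real.exp (-(1 / 4)) := by
      linarith [Real.add_one_le_exp (-(1 / 4) : ℝ)]
    calc (3 / 4 : ℝ) ^ k ≤ Real.exp (-(1 / 4)) ^ k := by gcongr
      _ = Real.exp (-(k / 4)) := by
          rw [← Real.exp_nat_mul]
          ring_nf
      _ ≤ Real.exp ((4 : ℕ) * Real.log ε) := by
          rw [Real.log_inv] at hk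
          apply Real.exp_le_exp.2
          push_cast
          linarith
      _ = ε ^ 2 * ε ^ 2 := by
          rw [Real.exp_nat_mul, Real.exp_log h0]
          ring
      _ ≤ (15 / 16) ^ 2 * ε ^ 2 := by gcongr
      _ = _ := by ring
  · calc (3 / 4 : ℝ) ^ k ≤ (3 / 4) ^ 1 :=
          pow_le_pow_of_le_one (by norm_num) (by norm_num) hk1
      _ ≤ (15 / 16 * (15 / 16)) ^ 2 := by norm_num
      _ ≤ (15 / 16 * ε) ^ 2 := by gcongr

theorem beta_zero_add_le {ε : ℝ} (h0 : 0 < ε) {k : ℕ} (hk1 : 1 ≤ k)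
    (hk : 16 * Real.log ε⁻¹ ≤ k) :
    ENNReal.ofReal (beta 0 k 0) + k * ENNReal.ofReal (ε / (16 * k)) ≤ ENNReal.ofReal ε := by
  have hk0 : (0 : ℝ) < k := by exact_mod_cast hk1
  rw [← ENNReal.ofReal_natCast, ← ENNReal.ofReal_mul hk0.le,
    ← ENNReal.ofReal_add (beta_nonneg _ _ _) (by positivity)]
  apply ENNReal.ofReal_le_ofReal
  have h1 := beta_zero_le h0 hk1 hk
  have h2 : (k : ℝ) * (ε / (16 * k)) = ε / 16 := by field_simp
  linarith

/-- For d > 0 this gives log(T|Σ|C) ≥ log 2, so that d log 20 can be absorbed into d log(T|Σ|C). -/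
theorem two_le_card_of_natarajanDim {A B : Type*} [Fintype B] [Nonempty B] {F : Set (A → B)}
    {d : ℕ} (hd : natarajanDim F = d) (hd0 : d ≠ 0) : 2 ≤ Fintype.card B := by
  by_contra h
  have hsub : Subsingleton B := Fintype.card_le_one_iff_subsingleton.1 (by omega)
  have h0 : natarajanDim F = 0 := by
    refine nonpos_iff_eq_zero.1 (iSup₂_le fun S hS => ?_)
    obtain ⟨f, g, hfg, -⟩ := hS
    rw [Finset.eq_empty_of_forall_notMem fun a ha => hfg a ha (Subsingleton.elim _ _)]
    simp
  rw [h0] at hd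
  exact hd0 (by exact_mod_cast hd.symm)

theorem log_four_mem : 1 ≤ Real.log 4 ∧ Real.log 4 ≤ 2 := by
  have h : Real.log 4 = 2 * Real.log 2 := by
    rw [show (4 : ℝ) = 2 ^ 2 by norm_num, Real.log_pow]
    norm_num
  have h1 := Real.log_two_gt_d9
  have h2 := Real.log_two_lt_d9
  constructor <;> linarith

theorem log_two_le_log_div {δ : ℝ} (hδ0 : 0 < δ) (hδ : δ < 1 / 2) {k : ℕ} (hk : 1 ≤ k) :
    Real.log 2 ≤ Real.log (1 / (δ / k)) := by
  have hk1 : (1 : ℝ) ≤ k := by exact_mod_cast hk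
  have hk0 : (0 : ℝ) < k := by linarith
  apply Real.log_le_log (by norm_num)
  rw [one_div_div, le_div_iff₀ hδ0]
  linarith

/-- `RLFineTune` requests enough prompts for its guarantee. -/
theorem le_rlSampleComplexity {s d T k : ℕ} {C δ : ℝ} (hs : 1 ≤ s) (hsd : d ≠ 0 → 2 ≤ s)
    (hT : 1 ≤ T) (hC : 1 ≤ C) (hδ0 : 0 < δ) (hδ : δ < 1 / 2) (hk : 1 ≤ k) :
    1 ≤ rlSampleComplexity 20 d s T C errStar (δ / k) ∧
      d * Real.log (20 * (s : ℝ) ^ 2 * C * T) + Real.log (4 / (δ / k)) ≤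
        rlSampleComplexity 20 d s T C errStar (δ / k) / 10 := by
  have hk0 : (0 : ℝ) < k := by exact_mod_cast hk
  have hs' : (1 : ℝ) ≤ s := by exact_mod_cast hs
  have hT' : (1 : ℝ) ≤ T := by exact_mod_cast hT
  have hY1 : 1 ≤ T * s * C :=
    one_le_mul_of_one_le_of_one_le (one_le_mul_of_one_le_of_one_le hT' hs') hC
  have hY : 0 ≤ Real.log (T * s * C) := Real.log_nonneg hY1
  have hZ := log_two_le_log_div hδ0 hδ hk
  have h2 := Real.log_two_gt_d9
  obtain ⟨h4, -⟩ := log_four_mem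
  have hle : 20 * (d * Real.log (T * s * C) * Real.log 4 + Real.log (1 / (δ / k))) * 4 ≤
      rlSampleComplexity 20 d s T C errStar (δ / k) := by
    refine le_trans (le_of_eq ?_) (Nat.le_ceil _)
    rw [errStar]
    norm_num
    ring
  have hmain : d * Real.log (20 * (s : ℝ) ^ 2 * C * T) ≤
      8 * (d * Real.log (T * s * C) * Real.log 4) := by
    rcases eq_or_ne d 0 with rfl | hd
    · simp
    have hs2 : (2 : ℝ) ≤ s := by exact_mod_cast hsd hd
    have h5 : Real.log 2 ≤ Real.log (T * s * C) := by
      refine Real.log_le_log (by norm_num) (hs2.trans ?_)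
      calc (s : ℝ) = 1 * s * 1 := by ring
        _ ≤ T * s * C := by gcongr
    -- By `h5` this is at most 7 log(TsC), within the factor 8 = 20 · 4 / 10 coming from the
    -- constant 20, from 1/`errStar` and from N/10.
    have h6 : Real.log (20 * (s : ℝ) ^ 2 * C * T) ≤ 5 * Real.log 2 + 2 * Real.log (T * s * C) := by
      have : 5 * Real.log 2 + 2 * Real.log (T * s * C) =
          Real.log (2 ^ 5 * (T * s * C) ^ 2) := by
        rw [Real.log_mul (x := 2 ^ 5) (by norm_num) (by positivity), Real.log_pow, Real.log_pow]
        norm_num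
      rw [this]
      apply Real.log_le_log (by positivity)
      calc 20 * (s : ℝ) ^ 2 * C * T = 20 * (s ^ 2 * (C * T)) * 1 := by ring
        _ ≤ 2 ^ 5 * (s ^ 2 * (C * T)) * (C * T) := by
            gcongr
            · norm_num
            · exact one_le_mul_of_one_le_of_one_le hC hT'
        _ = _ := by ring
    have h7 : Real.log (T * s * C) ≤ Real.log (T * s * C) * Real.log 4 :=
      le_mul_of_one_le_right hY h4
    calc _ ≤ (d : ℝ) * (8 * (Real.log (T * s * C) * Real.log 4)) := by
          gcongr
          linarith
      _ = _ := by ring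
  have hlog : Real.log (4 / (δ / k)) ≤ 3 * Real.log (1 / (δ / k)) := by
    have : Real.log (4 / (δ / k)) = 2 * Real.log 2 + Real.log (1 / (δ / k)) := by
      rw [show (4 : ℝ) / (δ / k) = 2 ^ 2 * (1 / (δ / k)) by ring,
        Real.log_mul (by norm_num) (by positivity), Real.log_pow]
      norm_num
    linarith
  have hnn : 0 ≤ d * Real.log (T * s * C) * Real.log 4 := by positivity
  refine ⟨?_, by linarith⟩
  have : (0 : ℝ) < rlSampleComplexity 20 d s T C errStar (δ / k) := by linarith
  exact_mod_cast this

theorem log_one_div_div_le {δ Λ : ℝ} (hδ0 : 0 < δ) {k : ℕ} (hk : 1 ≤ k)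
    (hkΛ : k ≤ 16 * Λ) (hδΛ : Real.log δ⁻¹ ≤ Λ) : Real.log (1 / (δ / k)) ≤ 17 * Λ := by
  have hk0 : (0 : ℝ) < k := by exact_mod_cast hk
  rw [one_div_div, div_eq_mul_inv, Real.log_mul hk0.ne' (by positivity)]
  linarith [Real.log_le_sub_one_of_pos hk0]

theorem rlSampleComplexity_le {s d T k : ℕ} {C δ D Λ : ℝ} (hs : 1 ≤ s)
    (hT : 1 ≤ T) (hC : 1 ≤ C) (hδ0 : 0 < δ) (hδ : δ < 1 / 2) (hk : 1 ≤ k)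
    (hD : D = max (d : ℝ) 1) (hΛ : 1 ≤ Λ) (hkΛ : k ≤ 16 * Λ) (hδΛ : Real.log δ⁻¹ ≤ Λ)
    (hYΛ : Real.log C + Real.log T + Real.log s ≤ Λ) :
    (rlSampleComplexity 20 d s T C errStar (δ / k) : ℝ) ≤ 1600 * (D * Λ) := by
  have hs' : (0 : ℝ) < s := by exact_mod_cast hs
  have hT' : (0 : ℝ) < T := by exact_mod_cast hT
  have hdD : (d : ℝ) ≤ D := hD ▸ le_max_left _ _
  have hD1 : 1 ≤ D := hD ▸ le_max_right _ _
  have hY : Real.log (T * s * C) ≤ Λ := by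
    rw [Real.log_mul (by positivity) (by positivity), Real.log_mul hT'.ne' hs'.ne']
    linarith
  have hY0 : 0 ≤ Real.log (T * s * C) := by
    refine Real.log_nonneg (one_le_mul_of_one_le_of_one_le (one_le_mul_of_one_le_of_one_le ?_ ?_) hC)
    · exact_mod_cast hT
    · exact_mod_cast hs
  have hZ := log_one_div_div_le hδ0 hk hkΛ hδΛ
  have hZ0 := log_two_le_log_div hδ0 hδ hk
  have h2 := Real.log_two_gt_d9
  obtain ⟨h40, h4⟩ := log_four_mem
  have h1 : (d : ℝ) * Real.log (T * s * C) * Real.log 4 ≤ D * Λ * 2 := by gcongr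
  have h3 : Λ ≤ D * Λ := le_mul_of_one_le_left (by linarith) hD1
  have h0 : 0 ≤ (d : ℝ) * Real.log (T * s * C) * Real.log 4 := by positivity
  have hceil : (rlSampleComplexity 20 d s T C errStar (δ / k) : ℝ) ≤
      20 * (d * Real.log (T * s * C) * Real.log 4 + Real.log (1 / (δ / k))) * 4 + 1 := by
    have harg : 20 * (d * Real.log (T * s * C) * Real.log (1 / errStar) +
        Real.log (1 / (δ / k))) / errStar =
        20 * (d * Real.log (T * s * C) * Real.log 4 + Real.log (1 / (δ / k))) * 4 := by
      rw [errStar]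
      norm_num
      ring
    rw [rlSampleComplexity, harg]
    exact (Nat.ceil_lt_add_one (by linarith)).le
  linarith

theorem two_pow_mul_le {ε δ : ℝ} (h0 : 0 < ε) (h1 : ε < 1) (hδ0 : 0 < δ) {k N n : ℕ}
    (hk : 1 ≤ k) (hn : k * (1 + 32 * k / ε * (N + (1 + Real.log (1 / (δ / k))))) ≤ n) :
    2 ^ N * (1 - ENNReal.ofReal (ε / (16 * k)) / 2) ^ (n / k) ≤ ENNReal.ofReal (δ / k / 2) := by
  have hk1 : (1 : ℝ) ≤ k := by exact_mod_cast hk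
  have hk0 : (0 : ℝ) < k := by linarith
  have ht : ε / (32 * k) ≤ 1 := by
    rw [div_le_one (by positivity)]
    linarith
  have hhalf : ENNReal.ofReal (ε / (16 * k)) / 2 = ENNReal.ofReal (ε / (32 * k)) := by
    rw [show (2 : ℝ≥0∞) = ENNReal.ofReal 2 by simp, ← ENNReal.ofReal_div_of_pos (by norm_num)]
    congr 1
    field_simp
    norm_num
  rw [hhalf, ← ENNReal.ofReal_one, ← ENNReal.ofReal_sub _ (by positivity),
    ← ENNReal.ofReal_pow (by linarith), show (2 : ℝ≥0∞) = ENNReal.ofReal 2 by simp,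
    ← ENNReal.ofReal_pow (by norm_num), ← ENNReal.ofReal_mul (by positivity)]
  apply ENNReal.ofReal_le_ofReal
  set m := n / k
  -- The leading 1 in `hn` pays for the floor in n/k; the 1 beside the logarithm later gives e⁻¹ ≤
  -- 1/2.
  have hm1 : 32 * k / ε * (N + (1 + Real.log (1 / (δ / k)))) ≤ m := by
    have h2 : n < k * (m + 1) := by
      rw [mul_comm]
      exact Nat.lt_mul_of_div_lt (Nat.lt_succ_self _) hk
    have h3 : (n : ℝ) ≤ k * (m + 1) := by exact_mod_cast h2.le
    have := le_of_mul_le_mul_left (hn.trans h3) hk0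
    linarith
  have hm2 : N + (1 + Real.log (1 / (δ / k))) ≤ ε / (32 * k) * m := by
    calc N + (1 + Real.log (1 / (δ / k))) =
        ε / (32 * k) * (32 * k / ε * (N + (1 + Real.log (1 / (δ / k))))) := by field_simp
      _ ≤ _ := by gcongr
  have he : (2 : ℝ) ≤ Real.exp 1 := by linarith [Real.add_one_le_exp (1 : ℝ)]
  calc (2 : ℝ) ^ N * (1 - ε / (32 * k)) ^ m
      ≤ Real.exp 1 ^ N * Real.exp (-(ε / (32 * k))) ^ m := by
        gcongr
        linarith [Real.add_one_le_exp (-(ε / (32 * k)))]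
    _ = Real.exp (N - ε / (32 * k) * m) := by
        rw [← Real.exp_nat_mul, ← Real.exp_nat_mul, ← Real.exp_add]
        ring_nf
    _ ≤ Real.exp (-Real.log (1 / (δ / k)) + -1) := by
        apply Real.exp_le_exp.2
        linarith
    _ = δ / k * (Real.exp 1)⁻¹ := by
        rw [Real.exp_add, Real.exp_neg, Real.exp_log (by positivity), Real.exp_neg]
        simp
    _ ≤ δ / k * 2⁻¹ := by gcongr
    _ = _ := by ring

theorem rolloutsPerPrompt_le {C δ D Λ M : ℝ} {k N : ℕ} (hC : 1 ≤ C) (hδ0 : 0 < δ)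
    (hδ : δ < 1 / 2) (hk : 1 ≤ k) (hN : 1 ≤ N) (hD : 1 ≤ D) (hΛ : 1 ≤ Λ) (hkΛ : k ≤ 16 * Λ)
    (hδΛ : Real.log δ⁻¹ ≤ Λ) (hCΛ : Real.log C ≤ Λ) (hNΛ : (N : ℝ) ≤ 1600 * (D * Λ))
    (hM : Λ + Real.log D ≤ M) :
    (rolloutsPerPrompt C (δ / k) N : ℝ) ≤ 2000 * (C * M) := by
  have hk0 : (0 : ℝ) < k := by exact_mod_cast hk
  have hN1 : (1 : ℝ) ≤ N := by exact_mod_cast hN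
  have hZ := log_one_div_div_le hδ0 hk hkΛ hδΛ
  have hZ0 := log_two_le_log_div hδ0 hδ hk
  have h2 := Real.log_two_gt_d9
  obtain ⟨h40, h4⟩ := log_four_mem
  have hlogD := Real.log_nonneg hD
  have hlogC := Real.log_nonneg hC
  have hlogN := Real.log_nonneg hN1
  have hNle : Real.log N ≤ 1600 + (Real.log D + Λ) := by
    refine (Real.log_le_log (by linarith) hNΛ).trans ?_
    rw [Real.log_mul (by norm_num) (by positivity), Real.log_mul (by positivity) (by positivity)]
    linarith [Real.log_le_sub_one_of_pos (show (0 : ℝ) < 1600 by norm_num),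
      Real.log_le_sub_one_of_pos (show 0 < Λ by linarith)]
  have heq : Real.log (4 * N * C / (δ / k)) =
      Real.log 4 + Real.log N + Real.log C + Real.log (1 / (δ / k)) := by
    rw [show 4 * N * C / (δ / k) = 4 * N * C * (1 / (δ / k)) by ring,
      Real.log_mul (by positivity) (by positivity), Real.log_mul (by positivity) (by positivity),
      Real.log_mul (by norm_num) (by positivity)]
  have hle : Real.log (4 * N * C / (δ / k)) ≤ 1900 * M := by
    rw [heq]
    linarith
  have h0 : 0 ≤ Real.log (4 * N * C / (δ / k)) := by
    rw [heq]
    linarith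
  calc (rolloutsPerPrompt C (δ / k) N : ℝ) ≤ C * Real.log (4 * N * C / (δ / k)) + 1 :=
        (Nat.ceil_lt_add_one (by positivity)).le
    _ ≤ C * (1900 * M) + 100 * (C * M) := by
        gcongr
        have : 1 ≤ C * M := one_le_mul_of_one_le_of_one_le hC (by linarith)
        linarith
    _ = _ := by ring

end Parameters

end AutoCurriculum

/-! ### Assembly with explicit constants. -/

theorem mainTheorem4 :
    ∃ ck > (0 : ℝ), ∃ cn > (0 : ℝ), ∃ A > (0 : ℝ), ∃ p : ℕ,
    ∃ B > (0 : ℝ), ∃ q : ℕ,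
    ∀ (Tok : Type*) [Fintype Tok] [DecidableEq Tok] (T : ℕ) [NeZero T]
      (X : Set (List Tok)) (ρ : PMF X) (V : X → Tok → Bool)
      (Pi : Set (AutoCurriculum.Model Tok)) (d : ℕ)
      (πref : X → PMF (AutoCurriculum.Response Tok T)) (Cseq : ℝ)
      (πstar : AutoCurriculum.Model Tok)
      (erm : List (X × Set (AutoCurriculum.Response Tok T)) → AutoCurriculum.Model Tok)
      (plu : List Tok → Tok) (ε δ : ℝ) (s : ℕ) (D : ℝ) (L : List ℝ),
      AutoCurriculum.natarajanDim Pi = d →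
      AutoCurriculum.SparseVerifier V →
      πstar ∈ Pi →
      AutoCurriculum.accuracy ρ V (fun x => AutoCurriculum.modelAnswer πstar T x) = 1 →
      1 ≤ Cseq →
      AutoCurriculum.SequenceCoverage ρ πref πstar Cseq →
      AutoCurriculum.IsERM Pi erm →
      AutoCurriculum.IsPlurality plu →
      0 < ε → ε < 1 → 0 < δ → δ < 1 / 2 →
      s = Fintype.card Tok →
      D = max (d : ℝ) 1 →
      L = [Cseq, ε⁻¹, δ⁻¹, (T : ℝ), (s : ℝ)] →
      ∀ n : ℕ, D / ε * AutoCurriculum.polylog A p L ≤ n →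
        ENNReal.ofReal (1 - δ) ≤
          (AutoCurriculum.autoTuneRun ρ V πref Cseq erm plu ck cn d s ε δ n).toOuterMeasure
            {r | ENNReal.ofReal (1 - ε) ≤ AutoCurriculum.accuracy ρ V r.1} ∧
        ∀ r ∈ (AutoCurriculum.autoTuneRun ρ V πref Cseq erm plu ck cn d s ε δ n).support,
          (r.2.ref : ℝ) ≤ D * Cseq * AutoCurriculum.polylog B q (D :: L) ∧
          (r.2.model : ℝ) ≤ n * AutoCurriculum.polylog B q [ε⁻¹] ∧
          (n = ⌈D / ε * AutoCurriculum.polylog A p L⌉₊ →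
            (r.2.total : ℝ) ≤ D * Cseq * AutoCurriculum.polylog B q (D :: L) +
              D / ε * AutoCurriculum.polylog B q L) := by
  -- The power 3 comes from n ≳ k · (k/ε) · N with k ≲ Λ and N ≲ DΛ. The model cost kn has one more
  -- factor Λ, hence the power 4.
  refine ⟨1, one_pos, 20, by norm_num, 20000000, by norm_num, 3, 1000000000, by norm_num, 4, ?_⟩
  intro Tok _ _ T _ X ρ V Pi d πref Cseq πstar erm plu ε δ s D L hd hV hstar hacc hC hcov herm hplu
    hε0 hε1 hδ0 hδ1 hs hD hL n hn
  have : Nonempty Tok := ⟨πstar []⟩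
  have hs1 : 1 ≤ s := hs ▸ Fintype.card_pos
  have hT1 : 1 ≤ T := NeZero.one_le
  have hsd : d ≠ 0 → 2 ≤ s := fun h => hs ▸ AutoCurriculum.two_le_card_of_natarajanDim hd h
  have hD1 : 1 ≤ D := hD ▸ le_max_right _ _
  have hlC := Real.log_nonneg hC
  have hlε := Real.log_nonneg (one_le_inv₀ hε0 |>.2 hε1.le)
  have hlδ := Real.log_nonneg (one_le_inv₀ hδ0 |>.2 (by linarith))
  have hlT : 0 ≤ Real.log T := Real.log_natCast_nonneg T
  have hls : 0 ≤ Real.log s := Real.log_natCast_nonneg s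
  have hlD := Real.log_nonneg hD1
  obtain ⟨Λ, hΛ⟩ : ∃ Λ, Λ = 1 + (Real.log Cseq + (Real.log ε⁻¹ + (Real.log δ⁻¹ +
    (Real.log T + Real.log s)))) := ⟨_, rfl⟩
  have hΛ1 : 1 ≤ Λ := by linarith
  have hpL : ∀ A p, AutoCurriculum.polylog A p L = A * Λ ^ p := fun A p => by
    simp [AutoCurriculum.polylog, hL, hΛ]
  have hpDL : ∀ A p, AutoCurriculum.polylog A p (D :: L) = A * (Λ + Real.log D) ^ p := fun A p => by
    simp only [AutoCurriculum.polylog, hL, hΛ, List.map_cons, List.map_nil, List.sum_cons,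
      List.sum_nil]
    ring
  have hpε : ∀ A p, AutoCurriculum.polylog A p [ε⁻¹] = A * (1 + Real.log ε⁻¹) ^ p := fun A p => by
    simp [AutoCurriculum.polylog]
  rw [hpL] at hn ⊢
  simp only [hpL, hpDL, hpε]
  obtain ⟨k, hk⟩ : ∃ k, AutoCurriculum.numPhases 1 ε = k := ⟨_, rfl⟩
  have hk1 : 1 ≤ k := hk ▸ AutoCurriculum.one_le_numPhases hε0 hε1
  have hkl : 16 * Real.log ε⁻¹ ≤ k := hk ▸ AutoCurriculum.le_numPhases ε
  have hku : (k : ℝ) ≤ 16 * (1 + Real.log ε⁻¹) := hk ▸ AutoCurriculum.numPhases_le hε0 hε1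
  have hkΛ : (k : ℝ) ≤ 16 * Λ := by linarith
  have hk0 : (0 : ℝ) < k := by exact_mod_cast hk1
  have hNbounds := AutoCurriculum.le_rlSampleComplexity hs1 hsd hT1 hC hδ0 hδ1 hk1
  have hNu := AutoCurriculum.rlSampleComplexity_le hs1 hT1 hC hδ0 hδ1 hk1 hD hΛ1 hkΛ
    (by linarith) (by linarith)
  obtain ⟨N, hN⟩ : ∃ N, AutoCurriculum.rlSampleComplexity 20 d s T Cseq AutoCurriculum.errStar
    (δ / k) = N := ⟨_, rfl⟩
  rw [hN] at hNbounds hNu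
  obtain ⟨hN1, hNl⟩ := hNbounds
  have hDε : 1 ≤ D / ε := by
    rw [one_le_div hε0]
    linarith
  refine ⟨AutoCurriculum.expect_autoTuneRun_le ρ hV πref hC hd herm hplu hstar hacc hcov hk hN
    hk1 hδ0 hε0.le hN1 (by rwa [← hs]) (AutoCurriculum.two_pow_mul_le hε0 hε1 hδ0 hk1 ?_)
    (AutoCurriculum.beta_zero_add_le hε0 hk1 hkl), fun r hr => ?_⟩
  · refine le_trans ?_ hn
    have hZ := AutoCurriculum.log_one_div_div_le (Λ := Λ) hδ0 hk1 hkΛ (by linarith)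
    have hZ0 := AutoCurriculum.log_two_le_log_div hδ0 hδ1 hk1
    have hlog2 := Real.log_two_gt_d9
    have hDΛ : Λ ≤ D * Λ := le_mul_of_one_le_left (by linarith) hD1
    have hΛ3 : Λ ≤ D / ε * Λ ^ 3 := by
      calc Λ ≤ Λ ^ 3 := le_self_pow₀ hΛ1 (by norm_num)
        _ ≤ D / ε * Λ ^ 3 := le_mul_of_one_le_left (by positivity) hDε
    calc (k : ℝ) * (1 + 32 * k / ε * (N + (1 + Real.log (1 / (δ / k)))))
        ≤ 16 * Λ * (1 + 32 * (16 * Λ) / ε * (1618 * (D * Λ))) := by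
          have : N + (1 + Real.log (1 / (δ / k))) ≤ 1618 * (D * Λ) := by linarith
          have : 0 ≤ N + (1 + Real.log (1 / (δ / k))) := by
            have : (0 : ℝ) ≤ N := N.cast_nonneg
            linarith
          gcongr
      _ = 16 * Λ + 13254656 * (D / ε * Λ ^ 3) := by ring
      _ ≤ D / ε * (20000000 * Λ ^ 3) := by linarith
  · obtain ⟨href, hmodel⟩ := AutoCurriculum.cost_of_mem_support_autoTuneRun (by linarith) hk hN
      (by positivity) hr
    have hR := AutoCurriculum.rolloutsPerPrompt_le hC hδ0 hδ1 hk1 hN1 hD1 hΛ1 hkΛ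
      (by linarith) (by linarith) hNu (le_refl (Λ + Real.log D))
    set M := Λ + Real.log D
    have hM1 : 1 ≤ M := by linarith
    have hΛM : Λ ≤ M := by linarith
    have href' : (r.2.ref : ℝ) ≤ D * Cseq * (1000000000 * M ^ 4) := by
      calc (r.2.ref : ℝ) ≤
            k * (N * AutoCurriculum.rolloutsPerPrompt Cseq (δ / k) N) := by exact_mod_cast href
        _ ≤ 16 * M * (1600 * (D * M) * (2000 * (Cseq * M))) := by
            gcongr
            · linarith
            · exact hNu.trans (by gcongr)
        _ = D * Cseq * (51200000 * M ^ 3) := by ring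
        _ ≤ D * Cseq * (1000000000 * M ^ 4) := by
            gcongr
            · norm_num
            · norm_num
    have hmodel' : (r.2.model : ℝ) ≤ 16 * (1 + Real.log ε⁻¹) * n := by
      calc (r.2.model : ℝ) ≤ k * n := by exact_mod_cast hmodel
        _ ≤ _ := by gcongr
    refine ⟨href', hmodel'.trans ?_, fun hn' => ?_⟩
    · rw [mul_comm]
      have h1 : 1 + Real.log ε⁻¹ ≤ (1 + Real.log ε⁻¹) ^ 4 :=
        le_self_pow₀ (by linarith) (by norm_num)
      gcongr
      norm_num
    -- The threshold is at least 1, so rounding up at most doubles it.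
    · have hn2 : (n : ℝ) ≤ 2 * (D / ε * (20000000 * Λ ^ 3)) := by
        have h1 : 1 ≤ D / ε * (20000000 * Λ ^ 3) := by
          refine one_le_mul_of_one_le_of_one_le hDε ?_
          linarith [one_le_pow₀ hΛ1 (n := 3)]
        have h2 := (Nat.ceil_lt_add_one (zero_le_one.trans h1)).le
        rw [← hn'] at h2
        linarith
      have hmodel2 : (r.2.model : ℝ) ≤ D / ε * (1000000000 * Λ ^ 4) := by
        calc (r.2.model : ℝ) ≤ 16 * Λ * (2 * (D / ε * (20000000 * Λ ^ 3))) := by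
              refine hmodel'.trans ?_
              gcongr
              linarith
          _ = D / ε * (640000000 * Λ ^ 4) := by ring
          _ ≤ _ := by
              gcongr
              norm_num
      rw [AutoCurriculum.Cost.total, Nat.cast_add]
      exact add_le_add href' hmodel2
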